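/- For $d\ge 1$, $p>1$ let $\mathsf B^d_p=\{x\in\mathbb R^d:\|x\|_p\le 1\}$, where $\|x\|_p=(\sum_{i=1}^d|x_i|^p)^{1/p}$. For $\sigma>0$ and a map $\hat\theta:\mathbb R^d\to\mathbb R^d$ let $$\mathcal R(\hat\theta)=\sup_{\theta^\star\in\mathsf B^d_p}\mathbf E_{Y\sim N(\theta^\star,\sigma^2 I_d)}\big[\|\hat\theta(Y)-\theta^\star\|_2^2\big].$$ Let $\mathcal M(\mathsf B^d_p,\sigma)=\inf_{\hat\theta}\mathcal R(\hat\theta)$, the infimum being over all measurable $\hat\theta:\mathbb R^d\to\mathbb R^d$, be the minimax risk. Let $\mathcal R^{\mathsf{MLE}}(\mathsf B^d_p,\sigma)=\mathcal R(\Pi_{\mathsf B^d_p})$, where $\Pi_{\mathsf B^d_p}(y)=\arg\min_{\vartheta\in\mathsf B^d_p}\|\vartheta-y\|_2^2$ is the maximum likelihood estimator, and define the competitive ratio $$\mathcal C^{\mathsf{MLE}}(\mathsf B^d_p,\sigma)=\frac{\mathcal R^{\mathsf{MLE}}(\mathsf B^d_p,\sigma)}{\mathcal M(\mathsf B^d_p,\sigma)}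 .$$ Then, for noise levels $\sigma=\sigma(d)>0$, $$\lim_{d\to\infty}\mathcal C^{\mathsf{MLE}}(\mathsf B^d_p,\sigma)=\infty$$ in each of the following two situations. (i) $p\in(1,2)$ is fixed, independent of $d$, and, as $d\to\infty$, $\sigma^p d\to\infty$ and $\sigma^2\log d\to 0$. (ii) $p=p(d)$ depends on $d$, with $p(d)>1+\frac{1}{\log d+1}$ for all sufficiently large $d$ and $\limsup_{d\to\infty}p(d)<2$, and, as $d\to\infty$, $$\frac{\sigma^p d}{d^{\,2-p}\,(1-\frac1p)^{p/2}}\to\infty\qquad\text{and}\qquad \sigma^2\log d\to 0 .$$ (With $q=\frac{p}{p-1}$, the first of these conditions is equivalent to $\sigma\sqrt q\,d^{1/q}\to\infty$.) -/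

import Mathlib

open Filter Topology MeasureTheory ProbabilityTheory
open scoped ENNReal

noncomputable section

namespace GaussianSequence

/-- `ℝ^d` with its Euclidean norm. -/
abbrev E (d : ℕ) : Type := EuclideanSpace ℝ (Fin d)

/-- The unit ball `{x ∈ ℝ^d : ‖x‖_p ≤ 1}` with `‖x‖_p = (∑ i, |x i| ^ p) ^ (1 / p)`, for a real
exponent `p > 0`. -/
def lpBall (d : ℕ) (p : ℝ) : Set (E d) :=
  {x | (∑ i, |x i| ^ p) ^ (1 / p) ≤ 1}

/-- The law `N(θ, σ² I_d)` of the observation `Y = θ + σ ξ`, where `ξ ∼ N(0, I_d)`. -/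
def observationLaw {d : ℕ} (θ : E d) (σ : ℝ) : Measure (E d) :=
  (stdGaussian (E d)).map (fun ξ => θ + σ • ξ)

/-- The mean squared error of the estimator `est` at the parameter `θ`,
`E_{Y ∼ N(θ, σ² I_d)} ‖est Y - θ‖₂²`, as an extended nonnegative number. -/
def mse {d : ℕ} (σ : ℝ) (est : E d → E d) (θ : E d) : ℝ≥0∞ :=
  ∫⁻ y, ENNReal.ofReal (‖est y - θ‖ ^ 2) ∂(observationLaw θ σ)

/-- The worst-case mean squared error of the estimator `est` over the parameter set `Θ`. -/
def worstCaseRisk {d : ℕ} (Θ : Set (E d)) (σ : ℝ) (est : E d → E d) : ℝ≥0∞ :=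
  ⨆ θ ∈ Θ, mse σ est θ

/-- The minimax risk over `Θ`: the infimum is over all measurable estimators. -/
def minimaxRisk {d : ℕ} (Θ : Set (E d)) (σ : ℝ) : ℝ≥0∞ :=
  ⨅ (est : E d → E d) (_ : Measurable est), worstCaseRisk Θ σ est

/-- `θ` is a minimizer of `ϑ ↦ ‖ϑ - y‖₂²` over `Θ`. -/
def IsProj {d : ℕ} (Θ : Set (E d)) (y θ : E d) : Prop :=
  θ ∈ Θ ∧ ∀ ϑ ∈ Θ, ‖θ - y‖ ^ 2 ≤ ‖ϑ - y‖ ^ 2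

/-- The Euclidean projection of `y` onto `Θ`, which is the maximum likelihood estimate of a mean
in `Θ` from the Gaussian observation `y`. It is the unique minimizer whenever `Θ` is nonempty,
closed and convex. -/
def proj {d : ℕ} (Θ : Set (E d)) (y : E d) : E d :=
  Classical.epsilon (IsProj Θ y)

/-- The worst-case mean squared error of the maximum likelihood estimator over `Θ`. -/
def mleRisk {d : ℕ} (Θ : Set (E d)) (σ : ℝ) : ℝ≥0∞ :=
  worstCaseRisk Θ σ (proj Θ)

/-- The competitive ratio of the maximum likelihood estimator over `Θ`. -/
def mleCompRatio {d : ℕ} (Θ : Set (E d)) (σ : ℝ) : ℝ≥0∞ :=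
  mleRisk Θ σ / minimaxRisk Θ σ

/-- The threshold norm index `1 + 1 / (log d + 1)`. -/
def pThreshold (d : ℕ) : ℝ := 1 + 1 / (Real.log d + 1)

end GaussianSequence

end

/-! The projection is compared with soft thresholding. Thresholding at level `a σ` costs at most
`(2aσ)^(2-p)` for the signal, because the `ℓ^p` budget is at most one, plus a multiple of `d σ²
exp(-a²/4)` for the noise (`minimaxRisk_lpBall_le`).

The projection does worse because noise off the support of a sparse `θ` drags it away. Let `θ` be a
boundary point flat on `k` coordinates, with Euclidean norm `ρ = k^(1/2-1/p)`. If the projection `x`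
lies within `ηρ` of `θ`, a tangent-line bound leaves `x` at most `pη` of `ℓ^p` mass off the support
(`sum_compl_rpow_le`), so by Hölder `⟨ξ, x⟩` is at most a small fraction of the `ℓ^q` norm of the
noise, up to a term from the support. Yet minimality gives `2σ⟨ξ, z⟩ ≤ ‖z - θ‖² + 2σ⟨ξ, x⟩` for all
`z` in the ball, and some `z` has `⟨ξ, z⟩` comparable to that norm. This is a contradiction once `σ`
times the norm dominates `‖z - θ‖²`, so the error exceeds `ηρ` with probability at least one half.

For fixed `p`, put `X = σ d^(1/q)` and `u = σ^p d`. Choosing `k` so that `ρ²` is of order `min(1,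
X)` (`mleRisk_ge_of_sparse`), it remains to show that the minimax bound `B`, of order `σ^(2-p) (log
u)^((2-p)/2)`, satisfies `B → 0` and `B / X → 0`. The former follows from `σ² log d → 0`, the latter
from `u → ∞`, since `σ^(2-p) / X = u^(-1/q)`.

For varying `p`, a vertex suffices (`mleRisk_ge_of_vertex`): the `ℓ^q` norm of the noise is
typically at least a constant times `√q d^(1/q)`, so the projection has risk bounded below, while
thresholding with `a = 2√(log d)` has vanishing risk because `p` stays away from 2. -/

namespace GaussianSequence

/-! ### Gaussian noise in coordinates: moments, tails and counts -/

/-- The law of `d` independent standard Gaussian variables. -/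
noncomputable abbrev gaussPi (d : ℕ) : Measure (Fin d → ℝ) := Measure.pi fun _ => gaussianReal 0 1

lemma lintegral_observationLaw {d : ℕ} (θ : E d) {σ : ℝ} (hσ : σ ≠ 0) (f : E d → ℝ≥0∞) :
    ∫⁻ y, f y ∂(observationLaw θ σ) = ∫⁻ ξ, f (θ + σ • WithLp.toLp 2 ξ) ∂(gaussPi d) := by
  have h1 : MeasurableEmbedding (fun ξ : E d => θ + σ • ξ) :=
    ((Homeomorph.smulOfNeZero σ hσ).trans (Homeomorph.addLeft θ)).measurableEmbedding
  have h2 : MeasurableEmbedding (WithLp.toLp 2 : (Fin d → ℝ) → E d) :=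
    (MeasurableEquiv.toLp 2 (Fin d → ℝ)).measurableEmbedding
  rw [observationLaw, h1.lintegral_map, ← map_pi_eq_stdGaussian, h2.lintegral_map]

/-- Passing to the measurable hull of `bad` avoids any measurability assumption on `bad` or `f`; in
particular the projection need not be shown measurable. -/
lemma half_mul_le_lintegral {Ω : Type*} [MeasurableSpace Ω] {μ : Measure Ω} [IsProbabilityMeasure μ]
    {f : Ω → ℝ≥0∞} {c : ℝ≥0∞} {bad : Set Ω} (hbad : μ bad ≤ 1 / 2) (h : ∀ ω ∉ bad, c ≤ f ω) :
    1 / 2 * c ≤ ∫⁻ ω, f ω ∂μ := by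
  have hm : MeasurableSet (toMeasurable μ bad)ᶜ := (measurableSet_toMeasurable μ bad).compl
  have hA : 1 / 2 ≤ μ (toMeasurable μ bad)ᶜ := by
    rw [prob_compl_eq_one_sub (measurableSet_toMeasurable μ bad), measure_toMeasurable]
    calc (1 / 2 : ℝ≥0∞) = 1 - 1 / 2 := by simp
      _ ≤ _ := tsub_le_tsub_left hbad 1
  calc 1 / 2 * c ≤ c * μ (toMeasurable μ bad)ᶜ := by rw [mul_comm]; gcongr
    _ = ∫⁻ _ in (toMeasurable μ bad)ᶜ, c ∂μ := by rw [setLIntegral_const]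
    _ ≤ ∫⁻ ω in (toMeasurable μ bad)ᶜ, f ω ∂μ := by
        refine setLIntegral_mono' hm fun ω hω => h ω fun hb => hω (subset_toMeasurable μ bad hb)
    _ ≤ _ := setLIntegral_le_lintegral _ _

lemma integrable_gaussianReal_iff {f : ℝ → ℝ} :
    Integrable f (gaussianReal 0 1) ↔ Integrable (fun x => gaussianPDFReal 0 1 x * f x) := by
  rw [gaussianReal_of_var_ne_zero _ one_ne_zero]
  rw [integrable_withDensity_iff_integrable_smul' (measurable_gaussianPDF 0 1)
    (ae_of_all _ fun x => gaussianPDF_lt_top)]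
  simp [toReal_gaussianPDF]

/-- The Gaussian density absorbs the growth and leaves `x² exp(-x²/4)`. This moment later replaces a
tail estimate, as `1 ≤ exp((x² - a²)/4)` when `|x| > a`. -/
lemma integrable_sq_mul_exp_gaussianReal :
    Integrable (fun x : ℝ => x ^ 2 * Real.exp (x ^ 2 / 4)) (gaussianReal 0 1) := by
  rw [integrable_gaussianReal_iff]
  have h := (integrable_rpow_mul_exp_neg_mul_sq (b := 1 / 4) (by norm_num) (s := 2)
    (by norm_num)).const_mul ((√(2 * Real.pi))⁻¹)
  refine h.congr (ae_of_all _ fun x => ?_)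
  simp only [gaussianPDFReal, Real.rpow_two]
  have : Real.exp (-(1 / 4) * x ^ 2) = Real.exp (-(x - 0) ^ 2 / (2 * ((1 : NNReal) : ℝ))) *
      Real.exp (x ^ 2 / 4) := by
    rw [← Real.exp_add]; congr 1; push_cast; ring
  rw [this]; simp; ring

/-- The moment `E ξ² exp(ξ² / 4)` of a standard Gaussian variable. -/
noncomputable def sqExpMoment : ℝ := ∫ x, x ^ 2 * Real.exp (x ^ 2 / 4) ∂(gaussianReal 0 1)

lemma sqExpMoment_nonneg : 0 ≤ sqExpMoment := integral_nonneg fun x => by positivity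

/-- The density is bounded below on `[t, t + 1]`, where `x²/2 ≤ (t + 1)²/2 ≤ t² + 1`. -/
lemma exp_div_three_le_gaussianReal_Ici {t : ℝ} (ht : 0 ≤ t) :
    Real.exp (-t ^ 2 - 1) / 3 ≤ (gaussianReal 0 1).real (Set.Ici t) := by
  have hpi : (1 / 3 : ℝ) ≤ (√(2 * Real.pi))⁻¹ := by
    rw [one_div]
    refine inv_anti₀ (by positivity) ?_
    rw [Real.sqrt_le_left (by norm_num)]
    nlinarith [Real.pi_le_four]
  have h1 : ∀ x ∈ Set.Icc t (t + 1), ENNReal.ofReal (Real.exp (-t ^ 2 - 1) / 3) ≤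
      gaussianPDF 0 1 x := by
    intro x hx
    refine ENNReal.ofReal_le_ofReal ?_
    simp only [gaussianPDFReal, NNReal.coe_one, mul_one, sub_zero]
    rw [div_eq_mul_one_div, mul_comm]
    refine mul_le_mul hpi (Real.exp_le_exp.2 ?_) (Real.exp_nonneg _) (by positivity)
    nlinarith [hx.1, hx.2, sq_nonneg (t - 1), mul_nonneg ht ht,
      mul_self_nonneg (t + 1 - x), mul_nonneg (sub_nonneg.2 hx.2) ht]
  have h2 : ENNReal.ofReal (Real.exp (-t ^ 2 - 1) / 3) ≤ gaussianReal 0 1 (Set.Ici t) := by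
    calc ENNReal.ofReal (Real.exp (-t ^ 2 - 1) / 3)
        = ∫⁻ _ in Set.Icc t (t + 1), ENNReal.ofReal (Real.exp (-t ^ 2 - 1) / 3) := by
          simp
      _ ≤ ∫⁻ x in Set.Icc t (t + 1), gaussianPDF 0 1 x :=
          setLIntegral_mono' measurableSet_Icc h1
      _ = gaussianReal 0 1 (Set.Icc t (t + 1)) := (gaussianReal_apply 0 one_ne_zero _).symm
      _ ≤ _ := measure_mono Set.Icc_subset_Ici_self
  rw [Measure.real]
  exact (ENNReal.ofReal_le_iff_le_toReal (measure_ne_top _ _)).1 h2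

/-- Chebyshev's inequality for the number of coordinates exceeding a level. -/
lemma measure_card_filter_lt_le {d : ℕ} (F : Finset (Fin d)) (t : ℝ) {m : ℝ} (hm : 0 < m)
    (hmF : m ≤ (F.card : ℝ) * (gaussianReal 0 1).real (Set.Ici t)) :
    gaussPi d {ξ | ((F.filter fun i => t ≤ ξ i).card : ℝ) < m / 2} ≤ ENNReal.ofReal (4 / m) := by
  set π := (gaussianReal 0 1).real (Set.Ici t)
  set m' := (F.card : ℝ) * π
  have hm' : 0 < m' := hm.trans_le hmF
  let X : Fin d → ℝ → ℝ := fun i => if i ∈ F then (Set.Ici t).indicator 1 else 0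
  have hX1 : ∀ i, MemLp (X i) 2 (gaussianReal 0 1) := by
    intro i
    by_cases hi : i ∈ F
    · simp only [X, hi, if_true]
      exact memLp_indicator_const 2 measurableSet_Ici 1 (Or.inr (measure_ne_top _ _))
    · simp only [X, hi, if_false]
      exact MemLp.zero
  have hX : ∀ i, MemLp (fun ξ : Fin d → ℝ => X i (ξ i)) 2 (gaussPi d) := fun i =>
    (hX1 i).comp_measurePreserving (measurePreserving_eval _ i)
  let N : (Fin d → ℝ) → ℝ := ∑ i, fun ξ => X i (ξ i)
  have hN : ∀ ξ, N ξ = ((F.filter fun i => t ≤ ξ i).card : ℝ) := by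
    intro ξ
    simp only [N, Finset.sum_apply, X]
    rw [Finset.card_filter, Nat.cast_sum, ← Finset.sum_filter_add_sum_filter_not Finset.univ (· ∈ F)]
    rw [Finset.sum_congr (g := fun _ => (0:ℝ)) (rfl : Finset.univ.filter (¬ · ∈ F) = _)]
    · simp only [Finset.filter_univ_mem, Finset.sum_const_zero, add_zero]
      refine Finset.sum_congr rfl fun i hi => ?_
      simp [hi, Set.indicator_apply]
    · intro i hi
      simp only [Finset.mem_filter] at hi
      simp [hi.2]
  have hNL : MemLp N 2 (gaussPi d) := memLp_finsetSum' _ fun i _ => hX i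
  have hint : ∀ i, ∫ x, X i x ∂(gaussianReal 0 1) = if i ∈ F then π else 0 := by
    intro i
    by_cases hi : i ∈ F
    · simp only [X, hi, if_true]
      rw [integral_indicator_one measurableSet_Ici]
    · simp [X, hi]
  have hmean : (gaussPi d)[N] = m' := by
    simp only [N, Finset.sum_apply]
    rw [integral_finsetSum _ fun i _ => (hX i).integrable one_le_two]
    have : ∀ i, ∫ ξ : Fin d → ℝ, X i (ξ i) ∂(gaussPi d) = if i ∈ F then π else 0 := by
      intro i
      rw [← hint i]
      exact integral_comp_eval (hX1 i).aestronglyMeasurable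
    simp [this, m']
  have hvar : Var[N; gaussPi d] ≤ m' := by
    simp only [N]
    rw [variance_sum_pi hX1]
    calc ∑ i, Var[X i; gaussianReal 0 1] ≤ ∑ i, (if i ∈ F then π else 0) := by
          refine Finset.sum_le_sum fun i _ => ?_
          refine (variance_le_expectation_sq (hX1 i).aestronglyMeasurable).trans ?_
          rw [← hint i]
          refine le_of_eq (integral_congr_ae (ae_of_all _ fun x => ?_))
          by_cases hi : i ∈ F <;> by_cases hx : t ≤ x <;> simp [X, hi, hx]
      _ = m' := by simp [m']
  calc gaussPi d {ξ | ((F.filter fun i => t ≤ ξ i).card : ℝ) < m / 2}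
      ≤ gaussPi d {ξ | m' / 2 ≤ |N ξ - (gaussPi d)[N]|} := by
        refine measure_mono fun ξ hξ => ?_
        simp only [Set.mem_ofPred_eq, hmean] at hξ ⊢
        rw [← hN] at hξ
        rw [abs_sub_comm]
        refine le_trans ?_ (le_abs_self _)
        linarith
    _ ≤ ENNReal.ofReal (Var[N; gaussPi d] / (m' / 2) ^ 2) :=
        meas_ge_le_variance_div_sq hNL (by positivity)
    _ ≤ ENNReal.ofReal (4 / m) := by
        refine ENNReal.ofReal_le_ofReal ?_
        calc Var[N; gaussPi d] / (m' / 2) ^ 2 ≤ m' / (m' / 2) ^ 2 := by gcongr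
          _ = 4 / m' := by field_simp; norm_num
          _ ≤ 4 / m := by gcongr

/-- Markov's inequality for a sum of functions of the coordinates. -/
lemma measure_le_sum_comp_le {d : ℕ} (F : Finset (Fin d)) (hF : F.Nonempty) {g : ℝ → ℝ}
    (hg : ∀ x, 0 ≤ g x) (hgi : Integrable g (gaussianReal 0 1)) {C : ℝ} (hC : 0 < C)
    (hgC : ∫ x, g x ∂(gaussianReal 0 1) ≤ C) :
    gaussPi d {ξ | 8 * (F.card * C) ≤ ∑ i ∈ F, g (ξ i)} ≤ ENNReal.ofReal (1 / 8) := by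
  have hi : ∀ i, Integrable (fun ξ : Fin d → ℝ => g (ξ i)) (gaussPi d) := fun i =>
    integrable_comp_eval hgi
  have hcard : (0 : ℝ) < F.card := by exact_mod_cast hF.card_pos
  have h := mul_meas_ge_le_integral_of_nonneg (μ := gaussPi d)
    (f := fun ξ => ∑ i ∈ F, g (ξ i)) (ae_of_all _ fun ξ => Finset.sum_nonneg fun i _ => hg _)
    (integrable_finsetSum _ fun i _ => hi i) (8 * (F.card * C))
  rw [integral_finsetSum _ fun i _ => hi i] at h
  have : ∀ i, ∫ ξ : Fin d → ℝ, g (ξ i) ∂(gaussPi d) = ∫ x, g x ∂(gaussianReal 0 1) := fun i =>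
    integral_comp_eval hgi.aestronglyMeasurable
  simp only [this, Finset.sum_const, nsmul_eq_mul] at h
  rw [ENNReal.le_ofReal_iff_toReal_le (measure_ne_top _ _) (by norm_num)]
  change (gaussPi d).real _ ≤ _
  have h3 : (F.card : ℝ) * ∫ x, g x ∂(gaussianReal 0 1) ≤ F.card * C := by gcongr
  have h4 : 0 < F.card * C := by positivity
  have h5 := h.trans h3
  by_contra! hcon
  nlinarith

/-! ### Soft thresholding and the upper bound on the minimax risk -/

lemma mem_lpBall_iff {d : ℕ} {p : ℝ} (hp : 0 < p) {x : E d} :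
    x ∈ lpBall d p ↔ ∑ i, |x i| ^ p ≤ 1 := by
  have h0 : 0 ≤ ∑ i, |x i| ^ p := Finset.sum_nonneg fun i _ => by positivity
  simp only [lpBall, Set.mem_ofPred_eq]
  refine ⟨fun h => ?_, fun h => Real.rpow_le_one h0 h (by positivity)⟩
  by_contra! hlt
  exact absurd h (not_le.2 (Real.one_lt_rpow hlt (by positivity)))

/-- The soft-thresholding function. -/
noncomputable def softThreshold (l y : ℝ) : ℝ := y - max (-l) (min l y)

/-- Noise below the threshold keeps the estimate between `0` and `θ`, which gives `|θ|`; noise plus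
clipping moves it by at most `2l`. -/
lemma abs_softThreshold_add_sub_le_of_abs_le {l θ n : ℝ} (hl : 0 ≤ l) (hn : |n| ≤ l) :
    |softThreshold l (θ + n) - θ| ≤ min |θ| (2 * l) := by
  unfold softThreshold
  rw [abs_le] at hn
  refine le_min ?_ ?_
  · rw [abs_le]
    rcases abs_cases θ with h | h <;> rcases max_cases (-l) (min l (θ + n)) with h' | h' <;>
      rcases min_cases l (θ + n) with h'' | h'' <;> constructor <;> linarith
  · rw [abs_le]
    rcases max_cases (-l) (min l (θ + n)) with h' | h' <;>
      rcases min_cases l (θ + n) with h'' | h'' <;> constructor <;> linarith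

lemma abs_softThreshold_add_sub_le {l θ n : ℝ} (hl : 0 ≤ l) :
    |softThreshold l (θ + n) - θ| ≤ |n| + l := by
  unfold softThreshold
  rw [abs_le]
  rcases abs_cases n with h | h <;> rcases max_cases (-l) (min l (θ + n)) with h' | h' <;>
      rcases min_cases l (θ + n) with h'' | h'' <;> constructor <;> linarith

lemma sq_min_le_rpow_mul_rpow {p u v : ℝ} (hp : 0 < p) (hp2 : p ≤ 2) (hu : 0 ≤ u) (hv : 0 < v) :
    min u v ^ 2 ≤ v ^ (2 - p) * u ^ p := by
  have hm : 0 ≤ min u v := le_min hu hv.le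
  rcases hm.eq_or_lt with h | h
  · rw [← h]; simp; positivity
  · calc min u v ^ 2 = min u v ^ (2 - p) * min u v ^ p := by
          rw [← Real.rpow_add h]; simp
      _ ≤ _ := mul_le_mul (Real.rpow_le_rpow hm (min_le_right _ _) (by linarith))
          (Real.rpow_le_rpow hm (min_le_left _ _) hp.le) (by positivity) (by positivity)

/-- For `|x| ≤ a` the error `min |θ| (2aσ)` is interpolated between its two bounds with exponents
`p` and `2 - p`. For `|x| > a` the error is at most `2σ|x|`, weighted by `exp((x² - a²)/4) ≥ 1`. -/
lemma softThreshold_sq_error_le {p a σ θ x : ℝ} (hp : 0 < p) (hp2 : p ≤ 2) (ha : 0 < a)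
    (hσ : 0 < σ) :
    (softThreshold (a * σ) (θ + σ * x) - θ) ^ 2 ≤ (2 * a * σ) ^ (2 - p) * |θ| ^ p +
      4 * σ ^ 2 * Real.exp (-a ^ 2 / 4) * (x ^ 2 * Real.exp (x ^ 2 / 4)) := by
  have hl : 0 ≤ a * σ := by positivity
  have h1 : 0 ≤ (2 * a * σ) ^ (2 - p) * |θ| ^ p := by positivity
  by_cases hx : |x| ≤ a
  · have hn : |σ * x| ≤ a * σ := by
      rw [abs_mul, abs_of_pos hσ, mul_comm]; gcongr
    have h2 := abs_softThreshold_add_sub_le_of_abs_le (θ := θ) hl hn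
    calc (softThreshold (a * σ) (θ + σ * x) - θ) ^ 2
        = |softThreshold (a * σ) (θ + σ * x) - θ| ^ 2 := (sq_abs _).symm
      _ ≤ min |θ| (2 * (a * σ)) ^ 2 := by gcongr
      _ ≤ (2 * (a * σ)) ^ (2 - p) * |θ| ^ p :=
          sq_min_le_rpow_mul_rpow hp hp2 (abs_nonneg _) (by positivity)
      _ ≤ _ := by rw [← mul_assoc]; exact le_add_of_nonneg_right (by positivity)
  · push Not at hx
    have h2 := abs_softThreshold_add_sub_le (θ := θ) (n := σ * x) hl
    have h3 : |softThreshold (a * σ) (θ + σ * x) - θ| ≤ 2 * (σ * |x|) := by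
      rw [abs_mul, abs_of_pos hσ] at h2; nlinarith
    have h4 : 1 ≤ Real.exp (-a ^ 2 / 4) * Real.exp (x ^ 2 / 4) := by
      rw [← Real.exp_add]
      refine Real.one_le_exp ?_
      have : a ^ 2 ≤ |x| ^ 2 := by gcongr
      rw [sq_abs] at this
      linarith
    calc (softThreshold (a * σ) (θ + σ * x) - θ) ^ 2
        = |softThreshold (a * σ) (θ + σ * x) - θ| ^ 2 := (sq_abs _).symm
      _ ≤ (2 * (σ * |x|)) ^ 2 := by gcongr
      _ = 4 * σ ^ 2 * x ^ 2 * 1 := by rw [mul_pow, mul_pow, sq_abs]; ring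
      _ ≤ 4 * σ ^ 2 * x ^ 2 * (Real.exp (-a ^ 2 / 4) * Real.exp (x ^ 2 / 4)) := by gcongr
      _ = 4 * σ ^ 2 * Real.exp (-a ^ 2 / 4) * (x ^ 2 * Real.exp (x ^ 2 / 4)) := by ring
      _ ≤ _ := le_add_of_nonneg_left h1

/-- Risk bound for soft thresholding at level `a σ` over an `ℓ^p` ball. -/
lemma minimaxRisk_lpBall_le {d : ℕ} {p a σ : ℝ} (hp : 0 < p) (hp2 : p ≤ 2) (ha : 0 < a)
    (hσ : 0 < σ) :
    minimaxRisk (lpBall d p) σ ≤ ENNReal.ofReal ((2 * a * σ) ^ (2 - p) +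
      4 * σ ^ 2 * Real.exp (-a ^ 2 / 4) * (d * sqExpMoment)) := by
  let est : E d → E d := fun y => WithLp.toLp 2 fun i => softThreshold (a * σ) (y i)
  have hest : Measurable est := by
    refine (MeasurableEquiv.toLp 2 (Fin d → ℝ)).measurable.comp ?_
    refine measurable_pi_lambda _ fun i => ?_
    simp only [softThreshold]
    have : Measurable fun y : E d => y i := by fun_prop
    fun_prop
  refine (iInf₂_le est hest).trans (iSup₂_le fun θ hθ => ?_)
  rw [mem_lpBall_iff hp] at hθ
  rw [mse, lintegral_observationLaw θ hσ.ne']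
  let B : (Fin d → ℝ) → ℝ := fun ξ => ∑ i, ((2 * a * σ) ^ (2 - p) * |θ i| ^ p +
      4 * σ ^ 2 * Real.exp (-a ^ 2 / 4) * (ξ i ^ 2 * Real.exp (ξ i ^ 2 / 4)))
  have hle : ∀ ξ : Fin d → ℝ, ‖est (θ + σ • WithLp.toLp 2 ξ) - θ‖ ^ 2 ≤ B ξ := by
    intro ξ
    rw [EuclideanSpace.norm_sq_eq]
    refine Finset.sum_le_sum fun i _ => ?_
    rw [Real.norm_eq_abs, sq_abs]
    simpa [est] using softThreshold_sq_error_le hp hp2 ha hσ (θ := θ i) (x := ξ i)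
  have hi : ∀ i, Integrable (fun ξ : Fin d → ℝ => ξ i ^ 2 * Real.exp (ξ i ^ 2 / 4)) (gaussPi d) :=
    fun i => integrable_comp_eval (X := fun _ => ℝ) (μ := fun _ => gaussianReal 0 1) (i := i)
      (f := fun x : ℝ => x ^ 2 * Real.exp (x ^ 2 / 4))
      integrable_sq_mul_exp_gaussianReal
  have hi2 : ∀ i ∈ Finset.univ, Integrable (fun ξ : Fin d → ℝ => (2 * a * σ) ^ (2 - p) * |θ i| ^ p +
      4 * σ ^ 2 * Real.exp (-a ^ 2 / 4) * (ξ i ^ 2 * Real.exp (ξ i ^ 2 / 4))) (gaussPi d) :=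
    fun i _ => (integrable_const _).add ((hi i).const_mul _)
  have hB : ∫ ξ, B ξ ∂(gaussPi d) = (2 * a * σ) ^ (2 - p) * ∑ i, |θ i| ^ p +
      4 * σ ^ 2 * Real.exp (-a ^ 2 / 4) * (d * sqExpMoment) := by
    have : ∀ i, ∫ ξ : Fin d → ℝ, ξ i ^ 2 * Real.exp (ξ i ^ 2 / 4) ∂(gaussPi d) = sqExpMoment :=
      fun i => integral_comp_eval (X := fun _ => ℝ) (μ := fun _ => gaussianReal 0 1) (i := i)
        (f := fun x : ℝ => x ^ 2 * Real.exp (x ^ 2 / 4))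
        integrable_sq_mul_exp_gaussianReal.aestronglyMeasurable
    simp only [B]
    rw [integral_finsetSum _ hi2]
    have h2 : ∀ i, ∫ ξ : Fin d → ℝ, ((2 * a * σ) ^ (2 - p) * |θ i| ^ p +
      4 * σ ^ 2 * Real.exp (-a ^ 2 / 4) * (ξ i ^ 2 * Real.exp (ξ i ^ 2 / 4))) ∂(gaussPi d) =
        (2 * a * σ) ^ (2 - p) * |θ i| ^ p + 4 * σ ^ 2 * Real.exp (-a ^ 2 / 4) * sqExpMoment := by
      intro i
      rw [integral_add (integrable_const _) ((hi i).const_mul _), integral_const_mul, integral_const_mul, this]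
      simp
    simp only [h2, Finset.sum_add_distrib, Finset.mul_sum, Finset.sum_const, Finset.card_univ,
      Fintype.card_fin, nsmul_eq_mul]
    ring
  calc ∫⁻ ξ, ENNReal.ofReal (‖est (θ + σ • WithLp.toLp 2 ξ) - θ‖ ^ 2) ∂(gaussPi d)
      ≤ ∫⁻ ξ, ENNReal.ofReal (B ξ) ∂(gaussPi d) :=
        lintegral_mono fun ξ => ENNReal.ofReal_le_ofReal (hle ξ)
    _ = ENNReal.ofReal (∫ ξ, B ξ ∂(gaussPi d)) := by
        rw [ofReal_integral_eq_lintegral_ofReal (integrable_finsetSum _ hi2)]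
        exact ae_of_all _ fun ξ => Finset.sum_nonneg fun i _ => by positivity
    _ ≤ _ := by
        rw [hB]
        refine ENNReal.ofReal_le_ofReal ?_
        gcongr
        exact mul_le_of_le_one_right (by positivity) hθ

/-! ### Projections onto the ball and flat boundary points -/

lemma isCompact_lpBall {d : ℕ} {p : ℝ} (hp : 0 < p) : IsCompact (lpBall d p) := by
  refine Metric.isCompact_of_isClosed_isBounded ?_ ?_
  · have : lpBall d p = {x : E d | ∑ i, |x i| ^ p ≤ 1} := Set.ext fun x => mem_lpBall_iff hp
    rw [this]
    refine isClosed_le ?_ continuous_const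
    refine continuous_finsetSum _ fun i _ => ?_
    exact Continuous.rpow_const (by fun_prop) fun _ => Or.inr hp.le
  · refine (Metric.isBounded_iff_subset_closedBall 0).2 ⟨√d, fun x hx => ?_⟩
    rw [mem_lpBall_iff hp] at hx
    rw [mem_closedBall_zero_iff, EuclideanSpace.norm_eq]
    refine Real.sqrt_le_sqrt ?_
    calc ∑ i, ‖x i‖ ^ 2 ≤ ∑ _i : Fin d, (1 : ℝ) := by
          refine Finset.sum_le_sum fun i _ => ?_
          have h1 : |x i| ^ p ≤ 1 := (Finset.single_le_sum (f := fun i => |x i| ^ p)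
            (fun i _ => by positivity) (Finset.mem_univ i)).trans hx
          have h2 : |x i| ≤ 1 := by
            by_contra! h
            exact absurd h1 (not_le.2 (Real.one_lt_rpow h hp))
          rw [Real.norm_eq_abs]
          exact pow_le_one₀ (abs_nonneg _) h2
      _ = d := by simp

/-- Compactness supplies a minimizer. Uniqueness is not needed, since everything below holds for any
minimizer. -/
lemma isProj_proj_lpBall {d : ℕ} {p : ℝ} (hp : 0 < p) (y : E d) :
    IsProj (lpBall d p) y (proj (lpBall d p) y) := by
  refine Classical.epsilon_spec (p := IsProj (lpBall d p) y) ?_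
  have h0 : (0 : E d) ∈ lpBall d p := by
    rw [mem_lpBall_iff hp]; simp [Real.zero_rpow hp.ne']
  obtain ⟨x, hx, hmin⟩ := (isCompact_lpBall hp).exists_isMinOn ⟨0, h0⟩
    (f := fun x : E d => ‖x - y‖ ^ 2) (by fun_prop)
  exact ⟨x, hx, fun z hz => hmin hz⟩

/-- Expand both squares around `θ`, cancel the terms free of the candidate, and drop `‖x - θ‖² ≥ 0`.
-/
lemma IsProj.two_mul_sum_le {d : ℕ} {Θ : Set (E d)} {θ x z : E d} {σ : ℝ} {ξ : Fin d → ℝ}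
    (hx : IsProj Θ (θ + σ • WithLp.toLp 2 ξ) x) (hz : z ∈ Θ) :
    2 * σ * ∑ i, ξ i * z i ≤ ‖z - θ‖ ^ 2 + 2 * σ * ∑ i, ξ i * x i := by
  have h := hx.2 z hz
  have key : ∀ w : E d, ‖w - (θ + σ • WithLp.toLp 2 ξ)‖ ^ 2 = ‖w - θ‖ ^ 2 -
      2 * σ * ∑ i, ξ i * w i + (2 * σ * ∑ i, ξ i * θ i + σ ^ 2 * ∑ i, ξ i ^ 2) := by
    intro w
    simp only [EuclideanSpace.norm_sq_eq, Real.norm_eq_abs, sq_abs, Finset.mul_sum,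
      ← Finset.sum_sub_distrib, ← Finset.sum_add_distrib]
    refine Finset.sum_congr rfl fun i _ => ?_
    simp
    ring
  rw [key, key] at h
  nlinarith [sq_nonneg ‖x - θ‖]

/-- The vector with the value `a` on `S` and zero elsewhere. -/
noncomputable def flatVec {d : ℕ} (S : Finset (Fin d)) (a : ℝ) : E d :=
  WithLp.toLp 2 fun i => if i ∈ S then a else 0

lemma flatVec_mem_lpBall {d : ℕ} {p a : ℝ} (hp : 0 < p) {S : Finset (Fin d)} (ha : 0 ≤ a)
    (hS : S.card * a ^ p ≤ 1) : flatVec S a ∈ lpBall d p := by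
  rw [mem_lpBall_iff hp]
  refine le_trans (le_of_eq ?_) hS
  have : ∀ i, |flatVec S a i| ^ p = if i ∈ S then a ^ p else 0 := by
    intro i
    by_cases hi : i ∈ S <;> simp [flatVec, hi, abs_of_nonneg ha, Real.zero_rpow hp.ne']
  simp [this]

lemma norm_flatVec {d : ℕ} {a : ℝ} {S : Finset (Fin d)} (ha : 0 ≤ a) :
    ‖flatVec S a‖ = √S.card * a := by
  have : ∀ i, ‖flatVec S a i‖ ^ 2 = if i ∈ S then a ^ 2 else 0 := by
    intro i
    by_cases hi : i ∈ S <;> simp [flatVec, hi]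
  rw [EuclideanSpace.norm_eq]
  simp only [this, Finset.sum_ite_mem, Finset.univ_inter, Finset.sum_const, nsmul_eq_mul]
  rw [Real.sqrt_mul (by positivity), Real.sqrt_sq ha]

/-- A point of the `ℓ^p` ball near a flat boundary point has little `ℓ^p` mass off its support. -/
lemma sum_compl_rpow_le {d : ℕ} {p a η : ℝ} (hp : 1 ≤ p) {S : Finset (Fin d)} (ha : 0 < a)
    (hS : S.card * a ^ p = 1) {x : E d} (hx : x ∈ lpBall d p)
    (hη : ‖x - flatVec S a‖ ≤ η * (√S.card * a)) :
    ∑ i ∈ Sᶜ, |x i| ^ p ≤ p * η := by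
  rw [mem_lpBall_iff (by linarith), ← Finset.sum_add_sum_compl S] at hx
  -- Tangent line to `t ↦ t^p` at `a`, from Bernoulli's inequality.
  have h1 : ∀ i ∈ S, a ^ p + p * a ^ (p - 1) * (x i - a) ≤ |x i| ^ p := by
    intro i _
    have hb := one_add_mul_self_le_rpow_one_add (s := |x i| / a - 1) (by
      have : 0 ≤ |x i| / a := by positivity
      linarith) hp
    have e1 : (1 + (|x i| / a - 1)) ^ p = |x i| ^ p / a ^ p := by
      rw [add_sub_cancel, Real.div_rpow (abs_nonneg _) ha.le]
    rw [e1, le_div_iff₀ (by positivity)] at hb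
    refine le_trans ?_ hb
    have e2 : a ^ p = a ^ (p - 1) * a := by
      rw [← Real.rpow_add_one ha.ne', sub_add_cancel]
    rw [e2]
    have e3 : (1 + p * (|x i| / a - 1)) * (a ^ (p - 1) * a) =
        a ^ (p - 1) * a + p * a ^ (p - 1) * (|x i| - a) := by field_simp
    rw [e3]
    gcongr
    exact le_abs_self _
  have h2 := Finset.sum_le_sum h1
  rw [Finset.sum_add_distrib, Finset.sum_const, nsmul_eq_mul, hS, ← Finset.mul_sum] at h2
  -- Cauchy–Schwarz on `S` bounds the total decrease on the support, hence the `ℓ^p` mass released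
  -- from it.
  have h3 : -(∑ i ∈ S, (x i - a)) ≤ √S.card * ‖x - flatVec S a‖ := by
    have hcs := Finset.sum_mul_sq_le_sq_mul_sq S (fun _ => (1 : ℝ)) (fun i => x i - a)
    simp only [one_mul, one_pow, Finset.sum_const, nsmul_eq_mul, mul_one] at hcs
    have h4 : ∑ i ∈ S, (x i - a) ^ 2 ≤ ‖x - flatVec S a‖ ^ 2 := by
      rw [EuclideanSpace.norm_sq_eq]
      refine le_trans (le_of_eq ?_) (Finset.sum_le_univ_sum_of_nonneg (s := S) fun i => by positivity)
      refine Finset.sum_congr rfl fun i hi => ?_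
      simp [flatVec, hi]
    refine le_trans (neg_le_abs _) (abs_le_of_sq_le_sq' ?_ (by positivity)).2
    rw [mul_pow, Real.sq_sqrt (by positivity), sq_abs]
    exact hcs.trans (by gcongr)
  have h5 : p * a ^ (p - 1) * (-(∑ i ∈ S, (x i - a))) ≤ p * η := by
    calc p * a ^ (p - 1) * (-(∑ i ∈ S, (x i - a)))
        ≤ p * a ^ (p - 1) * (√S.card * (η * (√S.card * a))) := by
          gcongr
          exact h3.trans (by gcongr)
      _ = p * η * ((√S.card * √S.card) * (a ^ (p - 1) * a)) := by ring
      _ = p * η := by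
        rw [Real.mul_self_sqrt (by positivity), ← Real.rpow_add_one ha.ne', sub_add_cancel, hS,
          mul_one]
  nlinarith

/-- Hölder off `S`, where `x` has little `ℓ^p` mass, and Cauchy–Schwarz on `S`, where there are few
noise coordinates. -/
lemma sum_mul_le_of_near_flatVec {d : ℕ} {p q a η : ℝ} (hpq : p.HolderConjugate q)
    {S : Finset (Fin d)} (ha : 0 < a) (hS : S.card * a ^ p = 1) {x : E d} (hx : x ∈ lpBall d p)
    (hη : ‖x - flatVec S a‖ ≤ η * (√S.card * a)) (ξ : Fin d → ℝ) :
    ∑ i, ξ i * x i ≤ (p * η) ^ (1 / p) * (∑ i ∈ Sᶜ, |ξ i| ^ q) ^ (1 / q) +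
      (1 + η) * (√S.card * a) * √(∑ i ∈ S, ξ i ^ 2) := by
  rw [← Finset.sum_add_sum_compl S, add_comm]
  have hxc := sum_compl_rpow_le hpq.lt.le ha hS hx hη
  refine add_le_add ?_ ?_
  · calc ∑ i ∈ Sᶜ, ξ i * x i = ∑ i ∈ Sᶜ, x i * ξ i := by simp only [mul_comm]
      _ ≤ (∑ i ∈ Sᶜ, |x i| ^ p) ^ (1 / p) * (∑ i ∈ Sᶜ, |ξ i| ^ q) ^ (1 / q) :=
        Real.inner_le_Lp_mul_Lq _ _ _ hpq
      _ ≤ _ := by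
        have := hpq.pos
        gcongr
  · have hnx : ‖x‖ ≤ (1 + η) * (√S.card * a) := by
      have h := norm_add_le (x - flatVec S a) (flatVec S a)
      rw [sub_add_cancel, norm_flatVec ha.le] at h
      linarith
    have hcs := Finset.sum_mul_sq_le_sq_mul_sq S ξ (fun i => x i)
    have hxs : ∑ i ∈ S, x i ^ 2 ≤ ‖x‖ ^ 2 := by
      rw [EuclideanSpace.norm_sq_eq]
      simp only [Real.norm_eq_abs, sq_abs]
      exact Finset.sum_le_univ_sum_of_nonneg fun i => by positivity
    refine le_trans (abs_le_of_sq_le_sq' (b := ‖x‖ * √(∑ i ∈ S, ξ i ^ 2)) ?_ (by positivity)).2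
      (by gcongr)
    have h0 : 0 ≤ ∑ i ∈ S, ξ i ^ 2 := Finset.sum_nonneg fun i _ => by positivity
    rw [mul_pow, Real.sq_sqrt h0]
    refine hcs.trans ?_
    rw [mul_comm]
    gcongr

/-- If the projection of a noisy flat vector is near that vector, the noise correlates little with
every point of the ball. -/
lemma two_mul_sum_le_of_proj_near {d : ℕ} {p q a η σ : ℝ} (hpq : p.HolderConjugate q)
    {S : Finset (Fin d)} (ha : 0 < a) (hS : S.card * a ^ p = 1) (hσ : 0 < σ) {ξ : Fin d → ℝ}
    (hη : ‖proj (lpBall d p) (flatVec S a + σ • WithLp.toLp 2 ξ) - flatVec S a‖ ≤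
      η * (√S.card * a)) {z : E d} (hz : z ∈ lpBall d p) :
    2 * σ * ∑ i, ξ i * z i ≤ ‖z - flatVec S a‖ ^ 2 +
      2 * σ * ((p * η) ^ (1 / p) * (∑ i ∈ Sᶜ, |ξ i| ^ q) ^ (1 / q) +
      (1 + η) * (√S.card * a) * √(∑ i ∈ S, ξ i ^ 2)) := by
  have hproj := isProj_proj_lpBall hpq.pos (flatVec S a + σ • WithLp.toLp 2 ξ)
  refine (hproj.two_mul_sum_le hz).trans ?_
  gcongr
  exact sum_mul_le_of_near_flatVec hpq ha hS hproj.1 hη ξ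

/-- The equality case of Hölder for `|ξ|` on `F`, with the signs of `ξ` put back. -/
lemma exists_mem_lpBall_sum_eq {d : ℕ} {p q : ℝ} (hpq : p.HolderConjugate q) (F : Finset (Fin d))
    (ξ : Fin d → ℝ) :
    ∃ z ∈ lpBall d p, ∑ i, ξ i * z i = (∑ i ∈ F, |ξ i| ^ q) ^ (1 / q) := by
  obtain ⟨⟨g, hg, hgs⟩, -⟩ := NNReal.isGreatest_Lp F (fun i => Real.nnabs (ξ i)) hpq.symm
  refine ⟨WithLp.toLp 2 fun i => if i ∈ F then SignType.sign (ξ i) * (g i : ℝ) else 0, ?_, ?_⟩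
  · rw [mem_lpBall_iff hpq.pos]
    calc ∑ i, |(WithLp.toLp 2 fun i => if i ∈ F then (SignType.sign (ξ i) : ℝ) * (g i : ℝ) else 0 :
            E d) i| ^ p ≤ ∑ i, if i ∈ F then (g i : ℝ) ^ p else 0 := by
          refine Finset.sum_le_sum fun i _ => ?_
          by_cases hi : i ∈ F
          · simp only [hi, if_true, abs_mul]
            have := hpq.pos
            gcongr
            rw [NNReal.abs_eq]
            refine mul_le_of_le_one_left (g i).2 ?_
            rcases lt_trichotomy (ξ i) 0 with h | h | h <;> simp [h]
          · simp [hi, Real.zero_rpow hpq.ne_zero]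
      _ = ((∑ i ∈ F, g i ^ p : NNReal) : ℝ) := by push_cast; simp
      _ ≤ 1 := by exact_mod_cast hg
  · have := congrArg (fun x : NNReal => (x : ℝ)) hgs
    simp only [NNReal.coe_sum, NNReal.coe_mul, NNReal.coe_rpow, Real.coe_nnabs] at this
    rw [← this]
    simp only [mul_ite, mul_zero, Finset.sum_ite_mem, Finset.univ_inter]
    refine Finset.sum_congr rfl fun i _ => ?_
    rw [← mul_assoc, self_mul_sign]

lemma norm_le_one_of_mem_lpBall {d : ℕ} {p : ℝ} (hp : 0 < p) (hp2 : p ≤ 2) {x : E d}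
    (hx : x ∈ lpBall d p) : ‖x‖ ≤ 1 := by
  rw [mem_lpBall_iff hp] at hx
  have : ‖x‖ ^ 2 ≤ 1 ^ 2 := by
    rw [EuclideanSpace.norm_sq_eq]
    refine le_trans (Finset.sum_le_sum fun i _ => ?_) (hx.trans (by norm_num))
    have h1 : |x i| ^ p ≤ 1 := (Finset.single_le_sum (f := fun i => |x i| ^ p)
      (fun i _ => by positivity) (Finset.mem_univ i)).trans hx
    have h2 : |x i| ≤ 1 := by
      by_contra! h
      exact absurd h1 (not_le.2 (Real.one_lt_rpow h hp))
    rw [Real.norm_eq_abs, ← Real.rpow_two]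
    rcases (abs_nonneg (x i)).eq_or_lt with h | h
    · rw [← h]; simp [Real.zero_rpow hp.ne']
    · exact Real.rpow_le_rpow_of_exponent_ge h h2 hp2
  exact le_of_sq_le_sq this (by norm_num)

/-! ### Lower bounds on the risk of the projection -/

lemma half_mul_sq_le_mleRisk {d : ℕ} {Θ : Set (E d)} {θ : E d} (hθ : θ ∈ Θ) {σ r : ℝ} (hσ : 0 < σ)
    (hr : 0 ≤ r) {bad : Set (Fin d → ℝ)} (hbad : gaussPi d bad ≤ 1 / 2)
    (h : ∀ ξ ∉ bad, r < ‖proj Θ (θ + σ • WithLp.toLp 2 ξ) - θ‖) :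
    ENNReal.ofReal (r ^ 2 / 2) ≤ mleRisk Θ σ := by
  refine le_trans ?_ (le_iSup₂ (f := fun θ (_ : θ ∈ Θ) => mse σ (proj Θ) θ) θ hθ)
  rw [mse, lintegral_observationLaw θ hσ.ne']
  have := half_mul_le_lintegral (μ := gaussPi d) (c := ENNReal.ofReal (r ^ 2))
    (f := fun ξ => ENNReal.ofReal (‖proj Θ (θ + σ • WithLp.toLp 2 ξ) - θ‖ ^ 2)) hbad
    fun ξ hξ => ENNReal.ofReal_le_ofReal (by have := h ξ hξ; gcongr)
  refine le_trans (le_of_eq ?_) this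
  rw [div_eq_mul_inv, mul_comm, ENNReal.ofReal_mul (by norm_num), ENNReal.ofReal_inv_of_pos two_pos]
  simp

lemma integral_sq_gaussianReal : ∫ x : ℝ, x ^ 2 ∂(gaussianReal 0 1) = 1 := by
  have h := variance_of_integral_eq_zero (μ := gaussianReal 0 1) (X := id) aemeasurable_id
    (by simp)
  rw [variance_id_gaussianReal] at h
  simpa using h.symm

lemma integrable_abs_rpow_gaussianReal {q : ℝ} (hq : 0 < q) :
    Integrable (fun x : ℝ => |x| ^ q) (gaussianReal 0 1) := by
  have h := (memLp_id_gaussianReal' (μ := 0) (v := 1) (ENNReal.ofReal q) (by simp)).integrable_norm_rpow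
    (by simpa using hq) (by simp)
  simpa [ENNReal.toReal_ofReal hq.le] using h

lemma integrable_sq_gaussianReal : Integrable (fun x : ℝ => x ^ 2) (gaussianReal 0 1) := by
  simpa using integrable_abs_rpow_gaussianReal (q := 2) two_pos

lemma measure_sum_sq_ge_le {d : ℕ} {S : Finset (Fin d)} (hS : S.Nonempty) :
    gaussPi d {ξ | 8 * (S.card : ℝ) ≤ ∑ i ∈ S, ξ i ^ 2} ≤ ENNReal.ofReal (1 / 8) := by
  simpa using measure_le_sum_comp_le S hS (g := fun x => x ^ 2) (fun x => sq_nonneg x)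
    integrable_sq_gaussianReal one_pos integral_sq_gaussianReal.le

lemma mul_half_rpow_le_of_card_filter {d : ℕ} {F : Finset (Fin d)} {q t m : ℝ} {ξ : Fin d → ℝ}
    (hq : 0 < q) (ht : 0 ≤ t) (hm : 0 ≤ m)
    (h : m ≤ ((F.filter fun i => t ≤ ξ i).card : ℝ)) :
    t * m ^ (1 / q) ≤ (∑ i ∈ F, |ξ i| ^ q) ^ (1 / q) := by
  calc t * m ^ (1 / q) = (m * t ^ q) ^ (1 / q) := by
        rw [Real.mul_rpow hm (by positivity), one_div, Real.rpow_rpow_inv ht hq.ne', mul_comm]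
    _ ≤ (∑ i ∈ F, |ξ i| ^ q) ^ (1 / q) := by
        gcongr
        calc m * t ^ q ≤ ((F.filter fun i => t ≤ ξ i).card : ℝ) * t ^ q := by gcongr
          _ = ∑ i ∈ F.filter fun i => t ≤ ξ i, t ^ q := by simp
          _ ≤ ∑ i ∈ F.filter fun i => t ≤ ξ i, |ξ i| ^ q := by
              refine Finset.sum_le_sum fun i hi => ?_
              have := (Finset.mem_filter.1 hi).2.trans (le_abs_self _)
              gcongr
          _ ≤ _ := Finset.sum_le_sum_of_subset_of_nonneg (Finset.filter_subset _ _)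
              fun i _ _ => by positivity

/-- Lower bound on the risk of the projection at a vertex of the `ℓ^p` ball. -/
lemma mleRisk_ge_of_vertex {d : ℕ} {p q σ t m : ℝ} (hpq : p.HolderConjugate q) (hp2 : p ≤ 2)
    (hσ : 0 < σ) (ht : 0 ≤ t) (hd : 1 ≤ d)
    (hmF : m ≤ ((d : ℝ) - 1) * (gaussianReal 0 1).real (Set.Ici t)) (hm16 : 16 ≤ m)
    (hlarge : 4 + 12 * σ < σ * (t * (m / 2) ^ (1 / q))) :
    ENNReal.ofReal ((1 / 16) ^ 2 / 2) ≤ mleRisk (lpBall d p) σ := by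
  have hp := hpq.lt
  let S : Finset (Fin d) := {⟨0, hd⟩}
  have hcard : S.card = 1 := rfl
  have hcardc : ((Sᶜ).card : ℝ) = d - 1 := by
    rw [Finset.card_compl, hcard, Fintype.card_fin]; push_cast [hd]; ring
  have hS : (S.card : ℝ) * 1 ^ p = 1 := by simp [hcard]
  have hmem : flatVec S 1 ∈ lpBall d p := flatVec_mem_lpBall hpq.pos zero_le_one hS.le
  have hm : 0 < m := by linarith
  -- The two bad events have probability at most `1/8` and `4/m ≤ 1/4`.
  refine half_mul_sq_le_mleRisk hmem hσ (by norm_num)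
    (bad := {ξ | 8 * (S.card : ℝ) ≤ ∑ i ∈ S, ξ i ^ 2} ∪
      {ξ | (((Sᶜ).filter fun i => t ≤ ξ i).card : ℝ) < m / 2}) ?_ ?_
  · refine (measure_union_le _ _).trans ?_
    refine (add_le_add (measure_sum_sq_ge_le (by simp [S]))
      (measure_card_filter_lt_le Sᶜ t hm (by rw [hcardc]; exact hmF))).trans ?_
    rw [← ENNReal.ofReal_add (by norm_num) (by positivity)]
    have : (4 : ℝ) / m ≤ 4 / 16 := by gcongr
    calc ENNReal.ofReal (1 / 8 + 4 / m) ≤ ENNReal.ofReal (1 / 2) :=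
          ENNReal.ofReal_le_ofReal (by linarith)
      _ = 1 / 2 := by
          rw [one_div, ENNReal.ofReal_inv_of_pos two_pos]; simp
  · intro ξ hξ
    simp only [Set.mem_union, Set.mem_ofPred_eq, not_or, not_le, not_lt, hcard] at hξ
    obtain ⟨h1, h2⟩ := hξ
    by_contra! hnear
    -- Here `ρ = 1`, so the Hölder extremizer is admissible: `‖z - θ‖² ≤ 4` for every `z` in the
    -- ball.
    obtain ⟨z, hz, hzs⟩ := exists_mem_lpBall_sum_eq hpq Sᶜ ξ
    have key := two_mul_sum_le_of_proj_near hpq (η := 1 / 16) one_pos hS hσ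
      (by simpa [hcard] using hnear) hz
    rw [hzs] at key
    have hM := mul_half_rpow_le_of_card_filter (q := q) hpq.symm.pos ht (by positivity) h2
    set M := (∑ i ∈ Sᶜ, |ξ i| ^ q) ^ (1 / q)
    have hM0 : 0 ≤ M := by positivity
    have hη : (p * (1 / 16)) ^ (1 / p) ≤ 1 / 2 := by
      calc (p * (1 / 16)) ^ (1 / p) ≤ (1 / 4 : ℝ) ^ (1 / p) := by
            have := hpq.pos
            gcongr; linarith
        _ ≤ (1 / 4 : ℝ) ^ (1 / 2 : ℝ) := by
            refine Real.rpow_le_rpow_of_exponent_ge (by norm_num) (by norm_num) ?_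
            exact one_div_le_one_div_of_le hpq.pos hp2
        _ = 1 / 2 := by
            rw [← Real.sqrt_eq_rpow, show (1 / 4 : ℝ) = (1 / 2) ^ 2 by norm_num,
              Real.sqrt_sq (by norm_num)]
    have hξ0 : √(∑ i ∈ S, ξ i ^ 2) ≤ 2.9 := by
      rw [Real.sqrt_le_left (by norm_num)]
      norm_num at h1 ⊢; linarith
    have hzθ : ‖z - flatVec S 1‖ ^ 2 ≤ 4 := by
      have h3 := norm_sub_le z (flatVec S 1)
      have h4 := norm_le_one_of_mem_lpBall hpq.pos hp2 hz
      have h5 := norm_le_one_of_mem_lpBall hpq.pos hp2 hmem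
      nlinarith [norm_nonneg (z - flatVec S 1)]
    have e1 : (p * (1 / 16)) ^ (1 / p) * M ≤ 1 / 2 * M := by gcongr
    have e2 : (1 + 1 / 16) * (√(S.card : ℝ) * 1) * √(∑ i ∈ S, ξ i ^ 2) ≤ 4 := by
      rw [hcard]; norm_num; linarith
    have e3 : 2 * σ * M ≤ 4 + 2 * σ * (1 / 2 * M + 4) := by
      refine key.trans ?_
      gcongr
    have e4 : σ * (t * (m / 2) ^ (1 / q)) ≤ σ * M := by gcongr
    -- The bounds give `2σM ≤ 4 + σM + 8σ`, against `4 + 12σ < σM`.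
    nlinarith

set_option maxHeartbeats 1000000 in
/-- Lower bound on the risk of the projection at a flat `k`-sparse boundary point of the `ℓ^p`
ball. -/
lemma mleRisk_ge_of_sparse {d k : ℕ} {p q σ η C c : ℝ} (hpq : p.HolderConjugate q)
    (hp2 : p ≤ 2) (hσ : 0 < σ) (hk : 1 ≤ k) (hkd : 2 * k ≤ d) (hη : 0 ≤ η) (hη1 : η ≤ 1)
    (hC : 1 ≤ C) (hC' : ∫ x : ℝ, |x| ^ q ∂(gaussianReal 0 1) ≤ C)
    (hc : c = (gaussianReal 0 1).real (Set.Ici 1) / 4) (hd : 8 ≤ c * d)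
    (hηC : (p * η) ^ (1 / p) * (8 * C) ≤ c / 4)
    (hkσ : (k : ℝ) ^ (1 - 2 / p) ≤ c / 8 * (σ * d ^ (1 / q)))
    (hkc : 6 * (k : ℝ) ^ (1 / q) ≤ c / 4 * d ^ (1 / q)) :
    ENNReal.ofReal (η ^ 2 * (k : ℝ) ^ (1 - 2 / p) / 2) ≤ mleRisk (lpBall d p) σ := by
  have hp := hpq.lt
  have hp0 := hpq.pos
  have hq0 := hpq.symm.pos
  have hk0 : (0 : ℝ) < k := by exact_mod_cast hk
  have hd0 : (0 : ℝ) < d := by exact_mod_cast (show 0 < d by omega)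
  obtain ⟨S, -, hcard⟩ := Finset.exists_subset_card_eq (s := (Finset.univ : Finset (Fin d)))
    (n := k) (by simp; omega)
  have hcardc : ((Sᶜ).card : ℝ) = d - k := by
    rw [Finset.card_compl, hcard, Fintype.card_fin, Nat.cast_sub (by omega)]
  have hSne : S.Nonempty := Finset.card_pos.1 (by omega)
  have hScne : (Sᶜ).Nonempty := Finset.card_pos.1 (by
    rw [Finset.card_compl, hcard, Fintype.card_fin]; omega)
  have hkd' : 2 * (k : ℝ) ≤ d := by exact_mod_cast hkd
  set a : ℝ := (k : ℝ) ^ (-(1 / p)) with ha_def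
  have ha : 0 < a := by positivity
  have hS : (S.card : ℝ) * a ^ p = 1 := by
    rw [hcard, ha_def, ← Real.rpow_mul hk0.le, neg_mul, one_div_mul_cancel hp0.ne',
      Real.rpow_neg_one, mul_inv_cancel₀ hk0.ne']
  have hρ : (√(S.card : ℝ) * a) ^ 2 = (k : ℝ) ^ (1 - 2 / p) := by
    rw [mul_pow, Real.sq_sqrt (by positivity), hcard, ha_def, ← Real.rpow_natCast,
      ← Real.rpow_mul hk0.le]
    nth_rewrite 1 [← Real.rpow_one (k : ℝ)]
    rw [← Real.rpow_add hk0]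
    congr 1; push_cast; ring
  have hρk : √(S.card : ℝ) * a * √(k : ℝ) = (k : ℝ) ^ (1 / q) := by
    rw [hcard, mul_right_comm, Real.mul_self_sqrt hk0.le, ha_def]
    nth_rewrite 1 [← Real.rpow_one (k : ℝ)]
    rw [← Real.rpow_add hk0]
    congr 1
    have := hpq.inv_add_inv_eq_one
    simp only [one_div]; linarith
  set ρ := √(S.card : ℝ) * a with hρ_def
  have hρ0 : 0 ≤ ρ := by positivity
  have hmem : flatVec S a ∈ lpBall d p := flatVec_mem_lpBall hp0 ha.le hS.le
  -- Since `|Sᶜ| ≥ d/2`, the expected number of coordinates off `S` with noise at least 1 is at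
  -- least `2cd`.
  set m := 2 * (c * d) with hm_def
  have hm : 0 < m := by linarith
  have hc0 : 0 < c := by
    by_contra! h
    nlinarith
  have hX0 : 0 < σ * (d : ℝ) ^ (1 / q) := by positivity
  rw [← hρ, ← mul_pow]
  refine half_mul_sq_le_mleRisk hmem hσ (by positivity)
    (bad := {ξ | 8 * (S.card : ℝ) ≤ ∑ i ∈ S, ξ i ^ 2} ∪
      ({ξ | 8 * ((Sᶜ).card * C) ≤ ∑ i ∈ Sᶜ, |ξ i| ^ q} ∪
      {ξ | (((Sᶜ).filter fun i => 1 ≤ ξ i).card : ℝ) < m / 2})) ?_ ?_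
  · refine (measure_union_le _ _).trans ((add_le_add_right (measure_union_le _ _) _).trans ?_)
    refine (add_le_add (measure_sum_sq_ge_le hSne) (add_le_add
      (measure_le_sum_comp_le Sᶜ hScne (g := fun x => |x| ^ q) (fun x => by positivity)
        (integrable_abs_rpow_gaussianReal hq0) (by linarith) hC')
      (measure_card_filter_lt_le Sᶜ 1 hm ?_))).trans ?_
    · rw [hcardc, hm_def, hc]
      have : 0 ≤ (gaussianReal 0 1).real (Set.Ici 1) := measureReal_nonneg
      nlinarith
    rw [← ENNReal.ofReal_add (by norm_num) (by positivity),
      ← ENNReal.ofReal_add (by norm_num) (by positivity)]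
    have : (4 : ℝ) / m ≤ 4 / 16 := by gcongr; linarith
    calc ENNReal.ofReal (1 / 8 + (1 / 8 + 4 / m)) ≤ ENNReal.ofReal (1 / 2) :=
          ENNReal.ofReal_le_ofReal (by linarith)
      _ = 1 / 2 := by
          rw [one_div, ENNReal.ofReal_inv_of_pos two_pos]; simp
  · intro ξ hξ
    simp only [Set.mem_union, Set.mem_ofPred_eq, not_or, not_le, not_lt] at hξ
    obtain ⟨h1, h2, h3⟩ := hξ
    by_contra! hnear
    -- The comparison point is flat on `T` with height `d^(-1/p)`. Spreading it out keeps its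
    -- Euclidean norm below `ρ`, which the Hölder extremizer need not satisfy, so that `‖z - θ‖² ≤
    -- 4ρ²`.
    set T := (Sᶜ).filter fun i => 1 ≤ ξ i
    set b : ℝ := (d : ℝ) ^ (-(1 / p)) with hb_def
    have hb : 0 < b := by positivity
    have hTd : (T.card : ℝ) ≤ d := by
      exact_mod_cast (Finset.card_le_univ T).trans (by simp)
    have hz : flatVec T b ∈ lpBall d p := by
      refine flatVec_mem_lpBall hp0 hb.le ?_
      rw [hb_def, ← Real.rpow_mul hd0.le, neg_mul, one_div_mul_cancel hp0.ne', Real.rpow_neg_one,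
        ← div_eq_mul_inv]
      exact div_le_one_of_le₀ hTd hd0.le
    have key := two_mul_sum_le_of_proj_near hpq ha hS hσ hnear hz
    have hsum : c * d ^ (1 / q) ≤ ∑ i, ξ i * flatVec T b i := by
      calc c * (d : ℝ) ^ (1 / q) = c * d * b := by
            rw [mul_assoc, hb_def]
            nth_rewrite 2 [← Real.rpow_one (d : ℝ)]
            rw [← Real.rpow_add hd0]
            congr 2
            have := hpq.inv_add_inv_eq_one
            simp only [one_div]; linarith
        _ ≤ T.card * b := by gcongr; linarith
        _ = ∑ i ∈ T, 1 * b := by simp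
        _ ≤ ∑ i ∈ T, ξ i * b := by
            refine Finset.sum_le_sum fun i hi => ?_
            have := (Finset.mem_filter.1 hi).2
            gcongr
        _ = ∑ i, ξ i * flatVec T b i := by simp [flatVec]
    have hzn : ‖flatVec T b‖ ≤ ρ := by
      refine le_of_sq_le_sq ?_ hρ0
      rw [hρ, norm_flatVec hb.le, mul_pow, Real.sq_sqrt (by positivity)]
      calc (T.card : ℝ) * b ^ 2 ≤ d * b ^ 2 := by gcongr
        _ = (d : ℝ) ^ (1 - 2 / p) := by
            rw [hb_def, ← Real.rpow_natCast, ← Real.rpow_mul hd0.le]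
            nth_rewrite 1 [← Real.rpow_one (d : ℝ)]
            rw [← Real.rpow_add hd0]
            congr 1; push_cast; ring
        _ ≤ (k : ℝ) ^ (1 - 2 / p) := by
            refine Real.rpow_le_rpow_of_nonpos hk0 (by linarith) ?_
            rw [sub_nonpos, le_div_iff₀ hp0]; linarith
    have hzθ : ‖flatVec T b - flatVec S a‖ ^ 2 ≤ 4 * ρ ^ 2 := by
      have h4 := norm_sub_le (flatVec T b) (flatVec S a)
      rw [norm_flatVec (S := S) ha.le, ← hρ_def] at h4
      calc ‖flatVec T b - flatVec S a‖ ^ 2 ≤ (2 * ρ) ^ 2 := by gcongr; linarith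
        _ = 4 * ρ ^ 2 := by ring
    have hM : (∑ i ∈ Sᶜ, |ξ i| ^ q) ^ (1 / q) ≤ 8 * C * d ^ (1 / q) := by
      have hcd : ((Sᶜ).card : ℝ) ≤ d := by rw [hcardc]; linarith
      have hq1 : 1 / q ≤ 1 := by
        rw [div_le_one hq0]; exact hpq.symm.lt.le
      calc (∑ i ∈ Sᶜ, |ξ i| ^ q) ^ (1 / q) ≤ (8 * C * d) ^ (1 / q) := by
            gcongr
            refine h2.le.trans ?_
            rw [mul_assoc, mul_comm C]
            gcongr
        _ = (8 * C) ^ (1 / q) * d ^ (1 / q) := Real.mul_rpow (by linarith) hd0.le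
        _ ≤ 8 * C * d ^ (1 / q) := by
            gcongr
            calc (8 * C) ^ (1 / q) ≤ (8 * C) ^ (1 : ℝ) :=
                  Real.rpow_le_rpow_of_exponent_le (by linarith) hq1
              _ = 8 * C := Real.rpow_one _
    have hξS : √(∑ i ∈ S, ξ i ^ 2) ≤ 3 * √(k : ℝ) := by
      refine (Real.sqrt_le_sqrt (h1.le.trans (?_ : _ ≤ 3 ^ 2 * (k : ℝ)))).trans (le_of_eq ?_)
      · rw [hcard]; linarith
      · rw [Real.sqrt_mul (by norm_num), Real.sqrt_sq (by norm_num)]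
    have e1 : (p * η) ^ (1 / p) * (∑ i ∈ Sᶜ, |ξ i| ^ q) ^ (1 / q) ≤ c / 4 * d ^ (1 / q) := by
      calc (p * η) ^ (1 / p) * (∑ i ∈ Sᶜ, |ξ i| ^ q) ^ (1 / q)
          ≤ (p * η) ^ (1 / p) * (8 * C * d ^ (1 / q)) := by gcongr
        _ = (p * η) ^ (1 / p) * (8 * C) * d ^ (1 / q) := by ring
        _ ≤ _ := by gcongr
    have e2 : (1 + η) * ρ * √(∑ i ∈ S, ξ i ^ 2) ≤ c / 4 * d ^ (1 / q) := by
      calc (1 + η) * ρ * √(∑ i ∈ S, ξ i ^ 2) ≤ (1 + 1) * ρ * (3 * √(k : ℝ)) := by gcongr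
        _ = 6 * (k : ℝ) ^ (1 / q) := by rw [← hρk]; ring
        _ ≤ _ := hkc
    have e3 : 2 * σ * (c * d ^ (1 / q)) ≤ 4 * ρ ^ 2 +
        2 * σ * (c / 4 * d ^ (1 / q) + c / 4 * d ^ (1 / q)) := by
      calc 2 * σ * (c * (d : ℝ) ^ (1 / q)) ≤ 2 * σ * ∑ i, ξ i * flatVec T b i := by gcongr
        _ ≤ _ := key
        _ ≤ _ := by gcongr
    have e4 : 0 < c * (σ * (d : ℝ) ^ (1 / q)) := mul_pos hc0 hX0
    have e5 : 2 * σ * (c * (d : ℝ) ^ (1 / q)) = 2 * (c * (σ * (d : ℝ) ^ (1 / q))) := by ring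
    have e6 : 2 * σ * (c / 4 * (d : ℝ) ^ (1 / q) + c / 4 * d ^ (1 / q)) =
        c * (σ * (d : ℝ) ^ (1 / q)) := by ring
    have e7 : c / 8 * (σ * (d : ℝ) ^ (1 / q)) = c * (σ * (d : ℝ) ^ (1 / q)) / 8 := by ring
    rw [hρ, e5, e6] at e3
    rw [e7] at hkσ
    -- With `Y = c σ d^(1/q)`: `2Y ≤ 4ρ² + Y` while `4ρ² ≤ Y/2`, which is impossible for `Y > 0`.
    linarith

/-! ### Varying exponent: the vertex regime -/

lemma tendsto_div_nhds_top {f g : ℕ → ℝ≥0∞} {A B : ℕ → ℝ} (hA : ∀ᶠ d in atTop, 0 < A d)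
    (hB : ∀ᶠ d in atTop, 0 < B d) (hf : ∀ᶠ d in atTop, ENNReal.ofReal (A d) ≤ f d)
    (hg : ∀ᶠ d in atTop, g d ≤ ENNReal.ofReal (B d))
    (h : Tendsto (fun d => B d / A d) atTop (𝓝 0)) :
    Tendsto (fun d => f d / g d) atTop (𝓝 ∞) := by
  have h1 : Tendsto (fun d => (B d / A d)⁻¹) atTop atTop := by
    refine Tendsto.inv_tendsto_nhdsGT_zero (tendsto_nhdsWithin_iff.2 ⟨h, ?_⟩)
    filter_upwards [hA, hB] with d h2 h3 using div_pos h3 h2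
  refine tendsto_nhds_top_mono (ENNReal.tendsto_ofReal_atTop.comp h1) ?_
  filter_upwards [hB, hf, hg] with d h3 h4 h5
  simp only [Function.comp_apply, inv_div]
  rw [ENNReal.ofReal_div_of_pos h3]
  exact ENNReal.div_le_div h4 h5

lemma tendsto_log_natCast : Tendsto (fun d : ℕ => Real.log d) atTop atTop :=
  Real.tendsto_log_atTop.comp tendsto_natCast_atTop_atTop

lemma tendsto_noise_zero {σ : ℕ → ℝ} (hσ : ∀ d, 0 < σ d)
    (h : Tendsto (fun d : ℕ => σ d ^ 2 * Real.log d) atTop (𝓝 0)) : Tendsto σ atTop (𝓝 0) := by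
  have h2 : Tendsto (fun d => σ d ^ 2) atTop (𝓝 0) := by
    refine squeeze_zero' (Eventually.of_forall fun d => by positivity) ?_ h
    filter_upwards [tendsto_log_natCast.eventually_ge_atTop 1] with d hd
    exact le_mul_of_one_le_right (by positivity) hd
  have h3 := h2.sqrt
  simpa [Real.sqrt_sq (hσ _).le] using h3

/-- Uses `1 - 1/p = 1/q` and `p/q = p - 1`; it exposes `σ √q d^(1/q)`, the noise level times the
order of the `ℓ^q` norm of the noise. -/
lemma noise_condition_eq {d : ℕ} {p q σ : ℝ} (hpq : p.HolderConjugate q) (hσ : 0 < σ)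
    (hd : 0 < d) :
    (σ ^ p * (d : ℝ)) / ((d : ℝ) ^ (2 - p) * (1 - 1 / p) ^ (p / 2)) =
      (σ * √q * (d : ℝ) ^ (1 / q)) ^ p := by
  have hd0 : (0 : ℝ) < d := by exact_mod_cast hd
  have hq := hpq.symm.pos
  have h1 : 1 - 1 / p = q⁻¹ := by have := hpq.inv_add_inv_eq_one; simp only [one_div]; linarith
  have h2 : p / q = p - 1 := by
    have := hpq.symm.div_conj_eq_sub_one
    rw [div_eq_mul_inv, ← h1]; field_simp [hpq.ne_zero]
  rw [Real.mul_rpow (by positivity) (by positivity), Real.mul_rpow hσ.le (by positivity), h1,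
    Real.sqrt_eq_rpow, ← Real.rpow_mul hq.le, ← Real.rpow_mul hd0.le, Real.inv_rpow hq.le,
    one_div_mul_eq_div, one_div_mul_eq_div, h2, div_eq_iff (by positivity)]
  have h3 : (d : ℝ) = (d : ℝ) ^ (p - 1) * (d : ℝ) ^ (2 - p) := by
    rw [← Real.rpow_add hd0]; norm_num
  nth_rewrite 1 [h3]
  field_simp

/-- This is the role of the threshold: the expected number of coordinates above `√q / 2` is at least
of order `d exp(-q/4)`, and `q < log d + 2` makes this at least a multiple of `d^(3/4)`. -/
lemma conjExponent_lt_of_pThreshold_lt {d : ℕ} {p q : ℝ} (hpq : p.HolderConjugate q)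
    (hd : 0 < Real.log d) (h : pThreshold d < p) : q < Real.log d + 2 := by
  have h1 : 1 / (Real.log d + 1) < p - 1 := by unfold pThreshold at h; linarith
  rw [div_lt_iff₀ (by linarith)] at h1
  have h2 := hpq.sub_one_pos
  rw [hpq.conjugate_eq, div_lt_iff₀ h2]
  nlinarith

/-- A lower bound for the typical `ℓ^q` norm of a standard Gaussian vector. -/
lemma vertex_level_ge {d : ℕ} {q : ℝ} (hq : 1 ≤ q) :
    (Real.exp (-1 / 4) * (Real.exp (-1) / 12) / 2) * (√q * (d : ℝ) ^ (1 / q)) ≤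
      √q / 2 * ((d : ℝ) / 2 * (Real.exp (-(√q / 2) ^ 2 - 1) / 3) / 2) ^ (1 / q) := by
  have hq0 : 0 < q := by linarith
  have e1 : (d : ℝ) / 2 * (Real.exp (-(√q / 2) ^ 2 - 1) / 3) / 2 =
      d * Real.exp (-1 / 4 * q) * (Real.exp (-1) / 12) := by
    rw [div_pow, Real.sq_sqrt hq0.le, show -(q / 2 ^ 2) - 1 = -1 / 4 * q + -1 by ring, Real.exp_add]
    ring
  have e2 : Real.exp (-1) / 12 ≤ (Real.exp (-1) / 12) ^ (1 / q) := by
    have h1 : Real.exp (-1) ≤ 1 := Real.exp_le_one_iff.2 (by norm_num)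
    nth_rewrite 1 [← Real.rpow_one (Real.exp (-1) / 12)]
    exact Real.rpow_le_rpow_of_exponent_ge (by positivity) (by linarith)
      ((div_le_one hq0).2 hq)
  -- The `q`-th root turns the tail factor `exp(-q/4)` into a constant, so the level `√q / 2` is
  -- reached at constant cost.
  have e3 : Real.exp (-1 / 4 * q) ^ (1 / q) = Real.exp (-1 / 4) := by
    rw [← Real.exp_mul]; congr 1; field_simp
  rw [e1, Real.mul_rpow (by positivity) (by positivity), Real.mul_rpow (by positivity)
    (by positivity), e3]
  calc _ = √q / 2 * ((d : ℝ) ^ (1 / q) * Real.exp (-1 / 4) * (Real.exp (-1) / 12)) := by ring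
    _ ≤ _ := by gcongr

lemma eventually_mleRisk_ge_of_growing_exponent {p σ : ℕ → ℝ}
    (hthr : ∀ᶠ d in atTop, pThreshold d < p d) (hp2 : ∀ᶠ d in atTop, p d ≤ 2)
    (hσ : ∀ d, 0 < σ d) (hσ0 : Tendsto σ atTop (𝓝 0))
    (hgrow : Tendsto (fun d : ℕ => (σ d ^ p d * (d : ℝ)) /
          ((d : ℝ) ^ (2 - p d) * (1 - 1 / p d) ^ (p d / 2))) atTop atTop) :
    ∀ᶠ d in atTop, ENNReal.ofReal ((1 / 16) ^ 2 / 2) ≤ mleRisk (lpBall d (p d)) (σ d) := by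
  set κ := Real.exp (-1 / 4) * (Real.exp (-1) / 12) / 2 with hκ_def
  have hκ : 0 < κ := by positivity
  have hexp : Tendsto (fun d : ℕ => Real.exp (3 / 4 * Real.log d + -3 / 2) / 6) atTop atTop :=
    (Real.tendsto_exp_atTop.comp (tendsto_atTop_add_const_right _ _
      (tendsto_log_natCast.const_mul_atTop (by norm_num)))).atTop_div_const (by norm_num)
  filter_upwards [hthr, hp2, hσ0.eventually_le_const one_pos,
    hgrow.eventually_gt_atTop (max 1 (16 / κ) ^ 2), tendsto_log_natCast.eventually_gt_atTop 0,
    hexp.eventually_ge_atTop 16, eventually_ge_atTop 2] with d h1 h2 h3 h4 h5 h6 h7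
  have hd0 : (0 : ℝ) < d := by exact_mod_cast (show 0 < d by omega)
  have hd2 : (2 : ℝ) ≤ d := by exact_mod_cast h7
  have hp1 : 1 < p d := by
    refine lt_trans ?_ h1
    unfold pThreshold
    have : 0 < 1 / (Real.log d + 1) := by positivity
    linarith
  have hpq := Real.HolderConjugate.conjExponent hp1
  set q := (p d).conjExponent
  have hq0 := hpq.symm.pos
  have hq := conjExponent_lt_of_pThreshold_lt hpq h5 h1
  rw [noise_condition_eq hpq (hσ d) (by omega)] at h4
  set X := σ d * √q * (d : ℝ) ^ (1 / q) with hX_def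
  have hX0 : 0 < X := by have := hσ d; positivity
  -- The growth hypothesis controls `X ^ p d`; as `p d ≤ 2`, exceeding the square of a base at least
  -- 1 forces `X` above that base.
  have hX : 16 / κ < X := by
    refine (le_max_right 1 _).trans_lt ?_
    by_contra! hle
    refine absurd h4 (not_lt.2 ?_)
    calc X ^ p d ≤ (max 1 (16 / κ)) ^ p d := by gcongr
      _ ≤ (max 1 (16 / κ)) ^ (2 : ℝ) :=
        Real.rpow_le_rpow_of_exponent_le (le_max_left _ _) h2
      _ = _ := Real.rpow_two _
  have ht : 0 ≤ √q / 2 := by positivity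
  refine mleRisk_ge_of_vertex (m := (d : ℝ) / 2 * (Real.exp (-(√q / 2) ^ 2 - 1) / 3)) hpq h2 (hσ d)
    ht (by omega) ?_ ?_ ?_
  · have := exp_div_three_le_gaussianReal_Ici ht
    refine mul_le_mul (by linarith) this (by positivity) (by linarith)
  · refine h6.trans ?_
    calc Real.exp (3 / 4 * Real.log d + -3 / 2) / 6
        = d / 2 * (Real.exp (-((Real.log d + 2) / 4) - 1) / 3) := by
          nth_rewrite 2 [← Real.exp_log hd0]
          rw [show 3 / 4 * Real.log d + -3 / 2 = Real.log d + (-((Real.log d + 2) / 4) - 1) by ring,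
            Real.exp_add]
          ring
      _ ≤ _ := by
          rw [div_pow, Real.sq_sqrt hq0.le]
          gcongr
          linarith
  · have h8 := vertex_level_ge (d := d) hpq.symm.lt.le
    rw [div_lt_iff₀ hκ] at hX
    calc 4 + 12 * σ d ≤ 16 := by linarith
      _ < X * κ := hX
      _ = σ d * (κ * (√q * (d : ℝ) ^ (1 / q))) := by rw [hX_def]; ring
      _ ≤ _ := by
        have := hσ d
        gcongr

lemma tendsto_mleCompRatio_of_growing_exponent {p σ : ℕ → ℝ}
    (hthr : ∀ᶠ d in atTop, pThreshold d < p d)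
    (hlim : limsup (fun d => (p d : EReal)) atTop < 2) (hσ : ∀ d, 0 < σ d)
    (hgrow : Tendsto (fun d : ℕ => (σ d ^ p d * (d : ℝ)) /
          ((d : ℝ) ^ (2 - p d) * (1 - 1 / p d) ^ (p d / 2))) atTop atTop)
    (hlog : Tendsto (fun d : ℕ => σ d ^ 2 * Real.log d) atTop (𝓝 0)) :
    Tendsto (fun d : ℕ => mleCompRatio (lpBall d (p d)) (σ d)) atTop (𝓝 ∞) := by
  -- A fixed `r < 2` above `p d` keeps the exponent `2 - p d` away from zero.
  obtain ⟨r, hr1, hr2⟩ := EReal.lt_iff_exists_real_btwn.1 hlim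
  have hr2' : r < 2 := EReal.coe_lt_coe_iff.1 (lt_of_lt_of_eq hr2 (by norm_cast))
  have hpr : ∀ᶠ d in atTop, p d < r := by
    filter_upwards [eventually_lt_of_limsup_lt hr1] with d hd
    exact_mod_cast hd
  have hσ0 := tendsto_noise_zero hσ hlog
  have hv : Tendsto (fun d : ℕ => 2 * (2 * √(Real.log d)) * σ d) atTop (𝓝 0) := by
    have h1 := (hlog.sqrt).const_mul 4
    simp only [Real.sqrt_zero, mul_zero] at h1
    refine h1.congr fun d => ?_
    rw [Real.sqrt_mul (by positivity), Real.sqrt_sq (hσ d).le]; ring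
  have hlow := eventually_mleRisk_ge_of_growing_exponent hthr
    (hpr.mono fun d hd => hd.le.trans hr2'.le) hσ hσ0 hgrow
  have hfacts : ∀ᶠ d : ℕ in atTop, 1 < p d ∧ p d < r ∧ 0 < Real.log d ∧ (0 : ℝ) < d := by
    filter_upwards [hthr, hpr, tendsto_log_natCast.eventually_gt_atTop 0, eventually_gt_atTop 0]
      with d h1 h2 h3 h4
    refine ⟨lt_trans ?_ h1, h2, h3, by exact_mod_cast h4⟩
    unfold pThreshold
    have : 0 < 1 / (Real.log d + 1) := by positivity
    linarith
  -- The choice `a = 2√(log d)` makes `exp(-a²/4) = 1/d`.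
  have hE : ∀ᶠ d : ℕ in atTop, Real.exp (-(2 * √(Real.log d)) ^ 2 / 4) * (d * sqExpMoment) =
      sqExpMoment := by
    filter_upwards [hfacts] with d ⟨_, _, h3, h4⟩
    rw [mul_pow, Real.sq_sqrt h3.le, show -(2 ^ 2 * Real.log d) / 4 = -Real.log d by ring,
      Real.exp_neg, Real.exp_log h4, inv_mul_cancel_left₀ h4.ne']
  refine tendsto_div_nhds_top (A := fun _ => (1 / 16) ^ 2 / 2)
    (B := fun d => (2 * (2 * √(Real.log d)) * σ d) ^ (2 - p d) + 4 * σ d ^ 2 *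
      Real.exp (-(2 * √(Real.log d)) ^ 2 / 4) * (d * sqExpMoment))
    (Eventually.of_forall fun _ => by norm_num) ?_ hlow ?_ ?_
  · filter_upwards [hfacts] with d ⟨h1, h2, h3, h4⟩
    have := hσ d
    have := sqExpMoment_nonneg
    have : 0 < √(Real.log d) := Real.sqrt_pos.2 h3
    positivity
  · filter_upwards [hfacts] with d ⟨h1, h2, h3, h4⟩
    have : 0 < √(Real.log d) := Real.sqrt_pos.2 h3
    exact minimaxRisk_lpBall_le (by linarith) (by linarith) (by positivity) (hσ d)
  · rw [← zero_div ((1 / 16 : ℝ) ^ 2 / 2)]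
    refine Tendsto.div_const ?_ _
    have hlim2 : Tendsto (fun d : ℕ => (2 * (2 * √(Real.log d)) * σ d) ^ (2 - r) +
        4 * σ d ^ 2 * sqExpMoment) atTop (𝓝 0) := by
      have h1 := hv.rpow_const (p := 2 - r) (Or.inr (by linarith))
      have h2 := ((hσ0.pow 2).const_mul 4).mul_const sqExpMoment
      rw [Real.zero_rpow (by linarith)] at h1
      simpa using h1.add h2
    refine squeeze_zero' ?_ ?_ hlim2
    · refine Eventually.of_forall fun d => ?_
      have := hσ d
      have := sqExpMoment_nonneg
      positivity
    · filter_upwards [hfacts, hE, hv.eventually_le_const one_pos] with d ⟨h1, h2, h3, h4⟩ h5 h6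
      have := hσ d
      have : 0 < √(Real.log d) := Real.sqrt_pos.2 h3
      rw [mul_assoc _ (Real.exp _), h5]
      gcongr ?_ + _
      exact Real.rpow_le_rpow_of_exponent_ge (by positivity) h6 (by linarith)

/-! ### Fixed exponent: the sparse regime -/

lemma exists_shrinkage_constant {p : ℝ} (hp : 0 < p) {b : ℝ} (hb : 0 < b) :
    ∃ η : ℝ, 0 < η ∧ η ≤ 1 ∧ (p * η) ^ (1 / p) ≤ b := by
  refine ⟨min 1 (b ^ p / p), lt_min one_pos (by positivity), min_le_left _ _, ?_⟩
  calc (p * min 1 (b ^ p / p)) ^ (1 / p) ≤ (b ^ p) ^ (1 / p) := by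
        gcongr
        calc p * min 1 (b ^ p / p) ≤ p * (b ^ p / p) := by gcongr; exact min_le_right _ _
          _ = b ^ p := by field_simp
    _ = b := by rw [one_div, Real.rpow_rpow_inv hb.le hp.ne']

/-- The sparsity at which the `ℓ²` norm of a flat boundary point of the `ℓ^p` ball matches the
level `L`. -/
noncomputable def criticalSparsity (p L : ℝ) : ℕ := ⌈max 1 (L ^ (-(p / (2 - p))))⌉₊

lemma one_le_criticalSparsity (p L : ℝ) : 1 ≤ criticalSparsity p L :=
  Nat.one_le_iff_ne_zero.2 (Nat.ceil_pos.2 (lt_max_of_lt_left one_pos)).ne'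

lemma criticalSparsity_le (p L : ℝ) :
    (criticalSparsity p L : ℝ) ≤ 2 * max 1 (L ^ (-(p / (2 - p)))) := by
  have h := Nat.ceil_lt_add_one (a := max 1 (L ^ (-(p / (2 - p))))) (by positivity)
  have h1 := le_max_left (1 : ℝ) (L ^ (-(p / (2 - p))))
  unfold criticalSparsity
  linarith

lemma criticalSparsity_rpow_le {p L : ℝ} (hp : 0 < p) (hp2 : p < 2) (hL : 0 < L) :
    (criticalSparsity p L : ℝ) ^ (1 - 2 / p) ≤ L := by
  have h2 : (2 : ℝ) - p ≠ 0 := by linarith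
  have h : L ^ (-(p / (2 - p))) ≤ criticalSparsity p L :=
    (le_max_right _ _).trans (Nat.le_ceil _)
  calc (criticalSparsity p L : ℝ) ^ (1 - 2 / p) ≤ (L ^ (-(p / (2 - p)))) ^ (1 - 2 / p) := by
        refine Real.rpow_le_rpow_of_nonpos (by positivity) h ?_
        rw [sub_nonpos, le_div_iff₀ hp]; linarith
    _ = L := by
        rw [← Real.rpow_mul hL.le]
        have : -(p / (2 - p)) * (1 - 2 / p) = 1 := by field_simp; ring
        rw [this, Real.rpow_one]

/-- Rounding up costs at most a factor 2 because `0 ≤ 2/p - 1 ≤ 1`. Thus the squared norm of the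
flat point is at least `min(1, L) / 4`. -/
lemma inv_criticalSparsity_rpow_le {p L : ℝ} (hp : 1 < p) (hp2 : p < 2) (hL : 0 < L) :
    ((criticalSparsity p L : ℝ) ^ (1 - 2 / p))⁻¹ ≤ 2 * (1 + L⁻¹) := by
  have hp0 : 0 < p := by linarith
  have h2 : (2 : ℝ) - p ≠ 0 := by linarith
  have hτ : 0 ≤ 2 / p - 1 := by rw [sub_nonneg, le_div_iff₀ hp0]; linarith
  have hτ1 : 2 / p - 1 ≤ 1 := by rw [sub_le_iff_le_add, div_le_iff₀ hp0]; linarith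
  set s := L ^ (-(p / (2 - p))) with hs
  have hs0 : 0 < s := by positivity
  have hsτ : s ^ (2 / p - 1) = L⁻¹ := by
    rw [hs, ← Real.rpow_mul hL.le]
    have : -(p / (2 - p)) * (2 / p - 1) = -1 := by field_simp
    rw [this, Real.rpow_neg_one]
  rw [← Real.rpow_neg (by positivity), neg_sub]
  calc (criticalSparsity p L : ℝ) ^ (2 / p - 1) ≤ (2 * max 1 s) ^ (2 / p - 1) :=
        Real.rpow_le_rpow (by positivity) (criticalSparsity_le p L) hτ
    _ = 2 ^ (2 / p - 1) * (max 1 s) ^ (2 / p - 1) :=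
        Real.mul_rpow (by norm_num) (by positivity)
    _ ≤ 2 * (1 + L⁻¹) := by
        gcongr
        · calc (2 : ℝ) ^ (2 / p - 1) ≤ 2 ^ (1 : ℝ) :=
              Real.rpow_le_rpow_of_exponent_le (by norm_num) hτ1
            _ = 2 := Real.rpow_one 2
        · have hL' : 0 < L⁻¹ := by positivity
          rcases max_cases 1 s with h | h
          · rw [h.1, Real.one_rpow]; linarith
          · rw [h.1, hsτ]; linarith

lemma noise_rpow_eq {p q σ D : ℝ} (hpq : p.HolderConjugate q) (hp2 : p < 2) (hσ : 0 < σ)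
    (hD : 0 < D) :
    (σ * D ^ (1 / q)) ^ (-(p / (2 - p))) = D * (σ ^ p * D) ^ (-(1 / (2 - p))) := by
  have h2 : (2 : ℝ) - p ≠ 0 := by linarith
  have hp0 := hpq.ne_zero
  have hq : 1 / q = 1 - 1 / p := by
    have := hpq.inv_add_inv_eq_one; simp only [one_div]; linarith
  rw [Real.mul_rpow hσ.le (by positivity), Real.mul_rpow (by positivity) hD.le,
    ← Real.rpow_mul hD.le, ← Real.rpow_mul hσ.le, hq, mul_left_comm]
  nth_rewrite 2 [← Real.rpow_one D]
  rw [← Real.rpow_add hD]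
  congr 2
  · field_simp
  · field_simp; ring

lemma noise_rpow_div_eq {p q σ D : ℝ} (hpq : p.HolderConjugate q) (hσ : 0 < σ) (hD : 0 < D) :
    σ ^ (2 - p) / (σ * D ^ (1 / q)) = (σ ^ p * D) ^ (-(1 / q)) := by
  have hp0 := hpq.ne_zero
  have hq : 1 / q = 1 - 1 / p := by
    have := hpq.inv_add_inv_eq_one; simp only [one_div]; linarith
  rw [Real.mul_rpow (by positivity) hD.le, ← Real.rpow_mul hσ.le, div_eq_iff (by positivity),
    Real.rpow_neg hD.le, mul_mul_mul_comm, inv_mul_cancel₀ (by positivity), mul_one,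
    ← Real.rpow_add_one hσ.ne', hq]
  congr 1
  field_simp
  ring

/-- Relative to `d`, the critical sparsity is at most of order `1/d + u^(-1/(2-p))` with `u = σ^p d
→ ∞`. Hence the support is eventually a small fraction of the coordinates. -/
lemma tendsto_criticalSparsity_div {p q κ : ℝ} (hpq : p.HolderConjugate q) (hp2 : p < 2)
    (hκ : 0 < κ) {σ : ℕ → ℝ} (hσ : ∀ d, 0 < σ d)
    (hgrow : Tendsto (fun d : ℕ => σ d ^ p * (d : ℝ)) atTop atTop) :
    Tendsto (fun d : ℕ => (criticalSparsity p (κ * (σ d * (d : ℝ) ^ (1 / q))) : ℝ) / d) atTop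
      (𝓝 0) := by
  have h2 : 0 < 2 - p := by linarith
  have hu : Tendsto (fun d : ℕ => (σ d ^ p * (d : ℝ)) ^ (-(1 / (2 - p)))) atTop (𝓝 0) :=
    (tendsto_rpow_neg_atTop (by positivity)).comp hgrow
  have hlim : Tendsto (fun d : ℕ => 2 * ((d : ℝ)⁻¹ + κ ^ (-(p / (2 - p))) *
      (σ d ^ p * (d : ℝ)) ^ (-(1 / (2 - p))))) atTop (𝓝 0) := by
    simpa using ((tendsto_inv_atTop_zero.comp tendsto_natCast_atTop_atTop).add
      (hu.const_mul (κ ^ (-(p / (2 - p)))))).const_mul (2 : ℝ)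
  refine squeeze_zero' (Eventually.of_forall fun d => by positivity) ?_ hlim
  filter_upwards [eventually_gt_atTop 0] with d hd
  have hd0 : (0 : ℝ) < d := by exact_mod_cast hd
  have := hσ d
  rw [div_le_iff₀ hd0]
  refine (criticalSparsity_le _ _).trans ?_
  rw [Real.mul_rpow hκ.le (by positivity), noise_rpow_eq hpq hp2 (hσ d) hd0, mul_assoc 2]
  gcongr
  have e : ((d : ℝ)⁻¹ + κ ^ (-(p / (2 - p))) * (σ d ^ p * (d : ℝ)) ^ (-(1 / (2 - p)))) * d =
      1 + κ ^ (-(p / (2 - p))) * (d * (σ d ^ p * (d : ℝ)) ^ (-(1 / (2 - p)))) := by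
    rw [add_mul, inv_mul_cancel₀ hd0.ne']; ring
  rw [e]
  refine max_le ?_ ?_
  · exact le_add_of_nonneg_right (by positivity)
  · exact le_add_of_nonneg_left zero_le_one

/-- The order of the minimax risk over the `ℓ^p` ball, up to constants. -/
lemma minimaxRisk_lpBall_le_log {d : ℕ} {p σ : ℝ} (hp : 0 < p) (hp2 : p ≤ 2) (hσ : 0 < σ)
    (hu : 1 < σ ^ p * d) :
    minimaxRisk (lpBall d p) σ ≤ ENNReal.ofReal (σ ^ (2 - p) *
      ((16 * Real.log (σ ^ p * d)) ^ ((2 - p) / 2) + 4 * sqExpMoment)) := by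
  set u := σ ^ p * d with hu_def
  have hl : 0 < Real.log u := Real.log_pos hu
  have hu0 : 0 < u := by linarith
  have hd0 : (0 : ℝ) < d := by
    by_contra! h
    have : u ≤ 0 := mul_nonpos_of_nonneg_of_nonpos (by positivity) h
    linarith
  -- The level `a = 2√(log u)` gives `exp(-a²/4) = 1/u`, so the noise term is `σ² d / u = σ^(2-p)`
  -- up to a constant.
  have ha : 0 < 2 * √(Real.log u) := by have := Real.sqrt_pos.2 hl; positivity
  refine (minimaxRisk_lpBall_le hp hp2 ha hσ).trans (le_of_eq (congrArg _ ?_))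
  have e1 : (2 * (2 * √(Real.log u)) * σ) ^ (2 - p) =
      σ ^ (2 - p) * (16 * Real.log u) ^ ((2 - p) / 2) := by
    rw [Real.mul_rpow (by positivity) hσ.le, mul_comm]
    congr 1
    have : 2 * (2 * √(Real.log u)) = (16 * Real.log u) ^ (1 / 2 : ℝ) := by
      rw [← Real.sqrt_eq_rpow, Real.sqrt_mul (by norm_num), show (16 : ℝ) = 4 ^ 2 by norm_num,
        Real.sqrt_sq (by norm_num)]
      ring
    rw [this, ← Real.rpow_mul (by positivity), one_div_mul_eq_div]
  have e2 : σ ^ 2 * Real.exp (-(2 * √(Real.log u)) ^ 2 / 4) * d = σ ^ (2 - p) := by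
    rw [mul_pow, Real.sq_sqrt hl.le, show -(2 ^ 2 * Real.log u) / 4 = -Real.log u by ring,
      Real.exp_neg, Real.exp_log hu0, hu_def, Real.rpow_sub hσ, Real.rpow_two]
    field_simp
  rw [e1, mul_add, ← e2]
  ring

lemma tendsto_mleCompRatio_of_fixed_exponent {p : ℝ} (hp : 1 < p) (hp2 : p < 2) {σ : ℕ → ℝ}
    (hσ : ∀ d, 0 < σ d)
    (hgrow : Tendsto (fun d : ℕ => σ d ^ p * (d : ℝ)) atTop atTop)
    (hlog : Tendsto (fun d : ℕ => σ d ^ 2 * Real.log d) atTop (𝓝 0)) :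
    Tendsto (fun d : ℕ => mleCompRatio (lpBall d p) (σ d)) atTop (𝓝 ∞) := by
  have hp0 : 0 < p := by linarith
  have hpq := Real.HolderConjugate.conjExponent hp
  set q := p.conjExponent
  have hq0 := hpq.symm.pos
  have hK := sqExpMoment_nonneg
  have hσ0 := tendsto_noise_zero hσ hlog
  set C := max 1 (∫ x : ℝ, |x| ^ q ∂(gaussianReal 0 1))
  have hC : 1 ≤ C := le_max_left _ _
  set c := (gaussianReal 0 1).real (Set.Ici 1) / 4 with hc_def
  have hc : 0 < c := by
    have h := exp_div_three_le_gaussianReal_Ici (t := 1) zero_le_one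
    have : 0 < Real.exp (-(1 : ℝ) ^ 2 - 1) / 3 := by positivity
    rw [hc_def]; linarith
  obtain ⟨η, hη0, hη1, hη⟩ := exists_shrinkage_constant hp0 (b := c / 4 / (8 * C)) (by positivity)
  have hηC : (p * η) ^ (1 / p) * (8 * C) ≤ c / 4 := (le_div_iff₀ (by positivity)).1 hη
  let X : ℕ → ℝ := fun d => σ d * (d : ℝ) ^ (1 / q)
  let k : ℕ → ℕ := fun d => criticalSparsity p (c / 8 * X d)
  let B : ℕ → ℝ := fun d => σ d ^ (2 - p) *
      ((16 * Real.log (σ d ^ p * d)) ^ ((2 - p) / 2) + 4 * sqExpMoment)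
  have hkd : Tendsto (fun d => (k d : ℝ) / d) atTop (𝓝 0) :=
    tendsto_criticalSparsity_div hpq hp2 (by positivity) hσ hgrow
  have hd : Tendsto (fun d : ℕ => c * (d : ℝ)) atTop atTop :=
    tendsto_natCast_atTop_atTop.const_mul_atTop hc
  have hpos : ∀ᶠ d : ℕ in atTop, (0 : ℝ) < d := by
    filter_upwards [eventually_gt_atTop 0] with d hd
    exact_mod_cast hd
  have hX : ∀ᶠ d in atTop, 0 < X d := by
    filter_upwards [hpos] with d hd
    have := hσ d
    positivity
  have hk0 : ∀ d, (0 : ℝ) < k d := fun d => by exact_mod_cast one_le_criticalSparsity _ _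
  have hlow : ∀ᶠ d in atTop, ENNReal.ofReal (η ^ 2 * (k d : ℝ) ^ (1 - 2 / p) / 2) ≤
      mleRisk (lpBall d p) (σ d) := by
    have hkq : Tendsto (fun d => ((k d : ℝ) / d) ^ (1 / q)) atTop (𝓝 0) := by
      have h := hkd.rpow_const (p := 1 / q) (Or.inr (by positivity))
      rwa [Real.zero_rpow (by positivity)] at h
    filter_upwards [hpos, hX, hd.eventually_ge_atTop 8,
      hkd.eventually_le_const (u := 1 / 2) (by norm_num),
      hkq.eventually_le_const (u := c / 24) (by positivity)] with d h1 h2 h3 h4 h5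
    refine mleRisk_ge_of_sparse hpq hp2.le (hσ d) (one_le_criticalSparsity _ _) ?_ hη0.le hη1 hC
      (le_max_right _ _) hc_def h3 hηC (criticalSparsity_rpow_le hp0 hp2 (by positivity)) ?_
    · rw [div_le_iff₀ h1] at h4
      have : 2 * (k d : ℝ) ≤ d := by linarith
      exact_mod_cast this
    · rw [Real.div_rpow (by positivity) (by positivity), div_le_iff₀ (by positivity)] at h5
      linarith
  have hG : Tendsto (fun d : ℕ => (σ d ^ p * d) ^ (-(1 / q)) *
      ((16 * Real.log (σ d ^ p * d)) ^ ((2 - p) / 2) + 4 * sqExpMoment)) atTop (𝓝 0) := by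
    have h1 : Tendsto (fun u : ℝ => u ^ (-(1 / q)) *
        ((16 * Real.log u) ^ ((2 - p) / 2) + 4 * sqExpMoment)) atTop (𝓝 0) := by
      have h2 := (isLittleO_log_rpow_rpow_atTop ((2 - p) / 2)
        (s := 1 / q) (by positivity)).tendsto_div_nhds_zero
      have h3 := (tendsto_rpow_neg_atTop (y := 1 / q) (by positivity)).mul_const (4 * sqExpMoment)
      have h4 := (h2.const_mul ((16 : ℝ) ^ ((2 - p) / 2))).add h3
      simp only [mul_zero, zero_mul, add_zero] at h4
      refine h4.congr' ?_
      filter_upwards [eventually_gt_atTop 1] with u hu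
      rw [Real.mul_rpow (by norm_num) (Real.log_pos hu).le, Real.rpow_neg (by linarith),
        div_eq_mul_inv]
      ring
    exact h1.comp hgrow
  have hBX : Tendsto (fun d => B d / X d) atTop (𝓝 0) := by
    refine hG.congr' ?_
    filter_upwards [hpos] with d h1
    rw [← noise_rpow_div_eq hpq (hσ d) h1]
    simp only [B, X]
    ring
  have hB0 : ∀ᶠ d in atTop, 0 < B d := by
    filter_upwards [hgrow.eventually_gt_atTop 1] with d h1
    have := hσ d
    have := Real.log_pos h1
    positivity
  -- For `σ ≤ 1` one has `log u ≤ log d`, so `B` is at most `(16 σ² log d)^((2-p)/2)` plus a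
  -- multiple of `σ^(2-p)`.
  have hB : Tendsto B atTop (𝓝 0) := by
    have h1 := (hlog.const_mul 16).rpow_const (p := (2 - p) / 2) (Or.inr (by linarith))
    have h2 := (hσ0.rpow_const (p := 2 - p) (Or.inr (by linarith))).mul_const (4 * sqExpMoment)
    rw [mul_zero, Real.zero_rpow (by linarith)] at h1
    rw [Real.zero_rpow (by linarith), zero_mul] at h2
    have h3 := h1.add h2
    rw [add_zero] at h3
    refine squeeze_zero' (hB0.mono fun d h => h.le) ?_ h3
    filter_upwards [hpos, hσ0.eventually_le_const one_pos, hgrow.eventually_gt_atTop 1]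
      with d h4 h5 h6
    have hs := hσ d
    have hlu := Real.log_pos h6
    have e1 : σ d ^ (2 - p) = (σ d ^ 2) ^ ((2 - p) / 2) := by
      rw [← Real.rpow_two, ← Real.rpow_mul hs.le]; congr 1; ring
    have e2 : Real.log (σ d ^ p * d) ≤ Real.log d := by
      refine Real.log_le_log (by positivity) (mul_le_of_le_one_left h4.le ?_)
      exact Real.rpow_le_one hs.le h5 hp0.le
    simp only [B, mul_add]
    gcongr ?_ + _
    rw [e1, ← Real.mul_rpow (by positivity) (by positivity)]
    refine Real.rpow_le_rpow (by positivity) ?_ (by linarith)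
    nlinarith [sq_nonneg (σ d)]
  refine tendsto_div_nhds_top (A := fun d => η ^ 2 * (k d : ℝ) ^ (1 - 2 / p) / 2) (B := B)
    (Eventually.of_forall fun d => by have := hk0 d; positivity) hB0 hlow ?_ ?_
  · filter_upwards [hgrow.eventually_gt_atTop 1] with d h1
    exact minimaxRisk_lpBall_le_log hp0 hp2.le (hσ d) h1
  -- The reciprocal of the lower bound is at most a multiple of `1 + 1/X`, so `B → 0` and `B / X →
  -- 0` together suffice.
  · have hlim : Tendsto (fun d => 4 / η ^ 2 * (B d + 8 / c * (B d / X d))) atTop (𝓝 0) := by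
      simpa using (hB.add (hBX.const_mul (8 / c))).const_mul (4 / η ^ 2)
    refine squeeze_zero' ?_ ?_ hlim
    · filter_upwards [hB0] with d h1
      have := hk0 d
      positivity
    · filter_upwards [hB0, hX] with d h1 h2
      have h3 := inv_criticalSparsity_rpow_le hp hp2 (L := c / 8 * X d) (by positivity)
      calc B d / (η ^ 2 * (k d : ℝ) ^ (1 - 2 / p) / 2)
          = 2 / η ^ 2 * B d * ((k d : ℝ) ^ (1 - 2 / p))⁻¹ := by
            have := hk0 d
            field_simp
        _ ≤ 2 / η ^ 2 * B d * (2 * (1 + (c / 8 * X d)⁻¹)) := by gcongr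
        _ = _ := by field_simp; ring

end GaussianSequence

theorem theorem2 :
    (∀ p : ℝ, 1 < p → p < 2 →
      ∀ σ : ℕ → ℝ, (∀ d, 0 < σ d) →
        Tendsto (fun d : ℕ => σ d ^ p * (d : ℝ)) atTop atTop →
        Tendsto (fun d : ℕ => σ d ^ 2 * Real.log d) atTop (𝓝 0) →
        Tendsto (fun d : ℕ =>
          GaussianSequence.mleCompRatio (GaussianSequence.lpBall d p) (σ d)) atTop (𝓝 ∞)) ∧
    (∀ p : ℕ → ℝ, (∀ᶠ d in atTop, GaussianSequence.pThreshold d < p d) →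
      limsup (fun d => (p d : EReal)) atTop < 2 →
      ∀ σ : ℕ → ℝ, (∀ d, 0 < σ d) →
        Tendsto (fun d : ℕ => (σ d ^ p d * (d : ℝ)) /
          ((d : ℝ) ^ (2 - p d) * (1 - 1 / p d) ^ (p d / 2))) atTop atTop →
        Tendsto (fun d : ℕ => σ d ^ 2 * Real.log d) atTop (𝓝 0) →
        Tendsto (fun d : ℕ =>
          GaussianSequence.mleCompRatio (GaussianSequence.lpBall d (p d)) (σ d))
            atTop (𝓝 ∞)) :=
  ⟨fun _ hp hp2 _ hσ hgrow hlog =>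
      GaussianSequence.tendsto_mleCompRatio_of_fixed_exponent hp hp2 hσ hgrow hlog,
    fun _ hthr hlim _ hσ hgrow hlog =>
      GaussianSequence.tendsto_mleCompRatio_of_growing_exponent hthr hlim hσ hgrow hlog⟩
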